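/- A finite simple graph $G$ is a \emph{path graph} if it is the intersection graph of a family of subpaths of a tree: there are a finite tree $T$ and, for each vertex $v$ of $G$, a path $P_v$ of $T$ (possibly a single vertex) such that distinct vertices $u,v$ of $G$ are adjacent if and only if $P_u$ and $P_v$ have a common vertex. It is a \emph{minimal non-path graph} if it is not a path graph but every proper induced subgraph of it is one (equivalently, deleting any single vertex leaves a path graph). The graphs $F_0,\dots,F_{16}$ are the following; $F_i(n)$ has $n$ vertices, "complete to" means adjacent to all of, and only the edges mentioned are present. - $F_0(n)$, $n\ge 4$: the chordless cycle on $n$ vertices. - $F_1$: the bipartite claw (the graph obtained from $K_{1,3}$ by subdividing each edge once) plus a universal vertex. - $F_2$: the 3-sun (a triangle together with, for each of its edges, a new vertex adjacent to exactly the two ends of that edge) plus a universal vertex. - $F_3$: the graph consisting of a chordless path $x_0x_1x_2x_3$, two adjacent vertices $a,b$ with $a$ adjacent to $x_0,x_1,x_2$ and $b$ adjacent to $x_1,x_2,x_3$, and a vertex $q$ adjacent to $a,b$; plus a universal vertex. - $F_4$: the umbrella (a chordless path $x_0x_1x_2x_3x_4$, a vertex complete to this path, and a vertex adjacent to $x_2$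 only) plus a universal vertex. - $F_5(r+5)$, $r\ge2$: a chordless path $x_0x_1\cdots x_{r+1}$, a vertex $c$ adjacent to $x_1,\dots,x_r$, a vertex $q$ adjacent to $c$, and a universal vertex. - $F_6$: two adjacent vertices $a,b$; three pairwise nonadjacent vertices $s_1,s_2,s_3$ each adjacent to $a,b$; three further vertices whose neighbourhoods are $\{a,s_1\}$, $\{a,s_2\}$, $\{b,s_3\}$. - $F_7$: a triangle $a_1a_2a_3$; three pairwise nonadjacent vertices $s_1,s_2,s_3$ each complete to the triangle; for $i=1,2,3$ a vertex with neighbourhood $\{a_i,s_i\}$. - $F_8$: a triangle $a,b,c$; two nonadjacent vertices $s,t$ each complete to the triangle; three further vertices whose neighbourhoods are $\{a,b\}$, $\{a,c,s\}$, $\{b,c,t\}$. - $F_9$: as $F_8$, but with the three neighbourhoods $\{a,b\}$, $\{a,c,s\}$, $\{b,t\}$. - $F_{10}(r+5)$, $r\ge3$: a chordless path $x_0x_1\cdots x_{r+1}$, two adjacent vertices $a,b$ with $a$ adjacent to $x_0,\dots,x_r$ and $b$ adjacent to $x_1,\dots,x_{r+1}$, and a vertex $q$ adjacent to $a,b$.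 - $F_{11}(4r+4)$, $r\ge1$: a clique $s_0,\dots,s_{2r}$; two nonadjacent vertices $a,b$ each complete to it; for each $i$ modulo $2r+1$ a vertex $v_i$ adjacent to $s_i,s_{i+1}$. - $F_{12}(4r+4)$, $r\ge1$: $F_{11}(4r+4)$ with the additional edge $bv_0$. - $F_{13}(4r+5)$, $r\ge1$: a clique $s_0,\dots,s_{2r}$; two nonadjacent vertices $q,x$ each complete to it; vertices $v_i$ adjacent to $s_{i-1},s_i$ ($1\le i\le 2r$); a vertex $v_{2r+1}$ adjacent to $s_{2r},x$; a vertex $v_0$ adjacent to $s_1,\dots,s_{2r},x$. - $F_{14}(4r+5)$, $r\ge1$: as $F_{13}(4r+5)$, except that $v_0$ is adjacent to $s_0,x$ only. - $F_{15}(4r+6)$, $r\ge1$: a clique $s_0,\dots,s_{2r}$; two adjacent vertices $x,y$ and a vertex $q$ nonadjacent to both, all three complete to the clique; vertices $v_i$ adjacent to $s_{i-1},s_i$ ($1\le i\le 2r$); a vertex $v_0$ adjacent to $s_0,x$; a vertex $v_{2r+1}$ adjacent to $s_{2r},y$. - $F_{16}(4k+3)$, $k\ge2$: a clique $s_0,\dots,s_{2k-1}$;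 two nonadjacent vertices $a,b$ each complete to it; vertices $v_i$ adjacent to $s_{i-1},s_i$ ($1\le i\le 2k-1$); a vertex $v_0$ adjacent to $a,s_0$; a vertex $v_{2k}$ adjacent to $s_{2k-1},b$. \textbf{Theorem.} Each of the graphs $F_0,\dots,F_{16}$, including every member of each infinite family, is a minimal non-path graph. -/

import Mathlib

/-! Path graphs, minimal non-path graphs, and the graphs `F0`, ..., `F16`. -/

namespace PathGraphs

/-- `G` is a path graph: it is the intersection graph of a family `(P v)` of subpaths of a
(finite) tree `T`. Two subpaths intersect when their vertex sets do; a subpath may consist of a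
single vertex. -/
def IsPathGraph {V : Type*} (G : SimpleGraph V) : Prop :=
  ∃ (m : ℕ) (T : SimpleGraph (Fin m)) (a b : V → Fin m) (P : ∀ v, T.Path (a v) (b v)),
    T.IsTree ∧ ∀ u v, u ≠ v →
      (G.Adj u v ↔ ∃ x, x ∈ (P u).1.support ∧ x ∈ (P v).1.support)

/-- `G` is a minimal non-path graph: it is not a path graph, but every induced subgraph on a
proper subset of the vertices is one. -/
def IsMinimalNonPathGraph {V : Type*} (G : SimpleGraph V) : Prop :=
  ¬ IsPathGraph G ∧ ∀ s : Set V, s ≠ Set.univ → IsPathGraph (G.induce s)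

/-! `SimpleGraph.fromRel r` is the graph in which distinct `x`, `y` are adjacent iff `r x y` or
`r y x`. So every edge need only be listed in one of its two directions. -/

/-- Holes: the chordless cycle on `n` vertices (`n ≥ 4`). -/
def F0 (n : ℕ) : SimpleGraph (Fin n) := SimpleGraph.cycleGraph n

/-! ### Graphs with a universal vertex -/

/-- The bipartite claw (the claw with centre `0` and each edge `0 i` subdivided, `i` being
extended to the leaf `i + 3`), plus the universal vertex `7`. -/
def F1 : SimpleGraph (Fin 8) := SimpleGraph.fromRel fun x y =>
  x = 7 ∨ (x, y) ∈ ([(0, 1), (0, 2), (0, 3), (1, 4), (2, 5), (3, 6)] : List (Fin 8 × Fin 8))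

/-- The 3-sun (triangle `0 1 2`, with `3`, `4`, `5` adjacent to two of its vertices each),
plus the universal vertex `6`. -/
def F2 : SimpleGraph (Fin 7) := SimpleGraph.fromRel fun x y =>
  x = 6 ∨ (x, y) ∈ ([(0, 1), (0, 2), (1, 2), (3, 0), (3, 1), (4, 1), (4, 2), (5, 0), (5, 2)] :
    List (Fin 7 × Fin 7))

/-- The rising sun (chordless path `2 3 4 5`, two adjacent vertices `0` and `1`, with `0`
adjacent to `2 3 4` and `1` adjacent to `3 4 5`, and a vertex `6` adjacent to `0 1`), plus the
universal vertex `7`. -/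
def F3 : SimpleGraph (Fin 8) := SimpleGraph.fromRel fun x y =>
  x = 7 ∨ (x, y) ∈ ([(2, 3), (3, 4), (4, 5), (0, 1), (0, 2), (0, 3), (0, 4), (1, 3), (1, 4),
    (1, 5), (6, 0), (6, 1)] : List (Fin 8 × Fin 8))

/-- The umbrella (chordless path `0 1 2 3 4`, a vertex `5` adjacent to all of it, and a vertex
`6` adjacent to `2` only), plus the universal vertex `7`. -/
def F4 : SimpleGraph (Fin 8) := SimpleGraph.fromRel fun x y =>
  x = 7 ∨ (x, y) ∈ ([(0, 1), (1, 2), (2, 3), (3, 4), (5, 0), (5, 1), (5, 2), (5, 3), (5, 4),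
    (6, 2)] : List (Fin 8 × Fin 8))

/-- Vertices of `F5 r`. -/
inductive V5 (r : ℕ)
  | u | c | q
  | x (i : Fin (r + 2))

/-- `F5 r` is the graph `F₅(r+5)`, on `r + 5` vertices, used for `r ≥ 2`:
a chordless path `x 0, x 1, ..., x (r+1)`, a vertex `c` adjacent to the interior vertices of
the path, a vertex `q` adjacent to `c`, and a universal vertex `u`. -/
def F5 (r : ℕ) : SimpleGraph (V5 r) := SimpleGraph.fromRel fun
  | .x i, .x j => i.val + 1 = j.val
  | .c, .x i => 1 ≤ i.val ∧ i.val ≤ r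
  | .q, .c => True
  | .u, _ => True
  | _, _ => False

/-! ### Graphs without universal vertex and with exactly three simplicial vertices -/

/-- Clique `0 1`; pairwise nonadjacent vertices `2`, `3`, `4`, each adjacent to `0 1`; simplicial
vertices `5`, `6`, `7` with neighbourhoods `0 2`, `0 3`, `1 4`. -/
def F6 : SimpleGraph (Fin 8) := SimpleGraph.fromRel fun x y =>
  (x, y) ∈ ([(0, 1), (2, 0), (2, 1), (3, 0), (3, 1), (4, 0), (4, 1),
    (5, 0), (5, 2), (6, 0), (6, 3), (7, 1), (7, 4)] : List (Fin 8 × Fin 8))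

/-- Clique `0 1 2`; pairwise nonadjacent vertices `3`, `4`, `5`, each adjacent to `0 1 2`;
simplicial vertices `6`, `7`, `8` with neighbourhoods `0 3`, `1 4`, `2 5`. -/
def F7 : SimpleGraph (Fin 9) := SimpleGraph.fromRel fun x y =>
  (x, y) ∈ ([(0, 1), (0, 2), (1, 2), (3, 0), (3, 1), (3, 2), (4, 0), (4, 1), (4, 2),
    (5, 0), (5, 1), (5, 2), (6, 0), (6, 3), (7, 1), (7, 4), (8, 2), (8, 5)] :
    List (Fin 9 × Fin 9))

/-- Clique `0 1 2`; nonadjacent vertices `3`, `4`, each adjacent to `0 1 2`; simplicial vertices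
`5`, `6`, `7` with neighbourhoods `0 1`, `0 2 3`, `1 2 4`. -/
def F8 : SimpleGraph (Fin 8) := SimpleGraph.fromRel fun x y =>
  (x, y) ∈ ([(0, 1), (0, 2), (1, 2), (3, 0), (3, 1), (3, 2), (4, 0), (4, 1), (4, 2),
    (5, 0), (5, 1), (6, 0), (6, 2), (6, 3), (7, 1), (7, 2), (7, 4)] : List (Fin 8 × Fin 8))

/-- Clique `0 1 2`; nonadjacent vertices `3`, `4`, each adjacent to `0 1 2`; simplicial vertices
`5`, `6`, `7` with neighbourhoods `0 1`, `0 2 3`, `1 4`. -/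
def F9 : SimpleGraph (Fin 8) := SimpleGraph.fromRel fun x y =>
  (x, y) ∈ ([(0, 1), (0, 2), (1, 2), (3, 0), (3, 1), (3, 2), (4, 0), (4, 1), (4, 2),
    (5, 0), (5, 1), (6, 0), (6, 2), (6, 3), (7, 1), (7, 4)] : List (Fin 8 × Fin 8))

/-- Vertices of `F10 r`. -/
inductive V10 (r : ℕ)
  | a | b | q
  | x (i : Fin (r + 2))

/-- `F10 r` is the graph `F₁₀(r+5)`, on `r + 5` vertices, used for `r ≥ 3`:
a chordless path `x 0, x 1, ..., x (r+1)`, two adjacent vertices `a`, `b`, where `a` is adjacent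
to all of the path except `x (r+1)` and `b` to all of the path except `x 0`, and a vertex `q`
adjacent to `a` and `b`. -/
def F10 (r : ℕ) : SimpleGraph (V10 r) := SimpleGraph.fromRel fun
  | .x i, .x j => i.val + 1 = j.val
  | .a, .b => True
  | .a, .x i => i.val ≤ r
  | .b, .x i => 1 ≤ i.val
  | .q, .a => True
  | .q, .b => True
  | _, _ => False

/-! ### The families with many simplicial vertices

In all of them the vertices `s j` form a clique. -/

/-- Vertices of `F11 r` and `F12 r`. -/
inductive V11 (r : ℕ)
  | a | b
  | s (j : Fin (2 * r + 1))
  | v (i : Fin (2 * r + 1))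

/-- `F11 r` is the graph `F₁₁(4r+4)`, on `4r + 4` vertices, used for `r ≥ 1`:
a clique `s 0, ..., s (2r)`, two nonadjacent vertices `a`, `b`, each adjacent to the whole
clique, and for each `i` a vertex `v i` adjacent to `s i` and `s (i+1)`, indices
modulo `2r+1`. -/
def F11 (r : ℕ) : SimpleGraph (V11 r) := SimpleGraph.fromRel fun
  | .s _, .s _ => True
  | .a, .s _ => True
  | .b, .s _ => True
  | .v i, .s j => j = i ∨ j = i + 1
  | _, _ => False

/-- `F12 r` is the graph `F₁₂(4r+4)`, on `4r + 4` vertices, used for `r ≥ 1`: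
it is `F11 r` with the additional edge `b, v 0`. -/
def F12 (r : ℕ) : SimpleGraph (V11 r) := SimpleGraph.fromRel fun
  | .s _, .s _ => True
  | .a, .s _ => True
  | .b, .s _ => True
  | .v i, .s j => j = i ∨ j = i + 1
  | .b, .v i => i = 0
  | _, _ => False

/-- Vertices of `F13 r` and `F14 r`. -/
inductive V13 (r : ℕ)
  | q | x
  | s (j : Fin (2 * r + 1))
  | v (i : Fin (2 * r + 2))

/-- `F13 r` is the graph `F₁₃(4r+5)`, on `4r + 5` vertices, used for `r ≥ 1`:
a clique `s 0, ..., s (2r)`, two nonadjacent vertices `q`, `x`, each adjacent to the whole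
clique, vertices `v i` adjacent to `s (i-1)` and `s i` for `1 ≤ i ≤ 2r`, a vertex `v (2r+1)`
adjacent to `s (2r)` and `x`, and a vertex `v 0` adjacent to `s 1, ..., s (2r)` and `x`. -/
def F13 (r : ℕ) : SimpleGraph (V13 r) := SimpleGraph.fromRel fun
  | .s _, .s _ => True
  | .q, .s _ => True
  | .x, .s _ => True
  | .v i, .s j => (i.val = 0 ∧ 1 ≤ j.val) ∨ (1 ≤ i.val ∧ (j.val + 1 = i.val ∨ j.val = i.val))
  | .v i, .x => i.val = 0 ∨ i.val = 2 * r + 1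
  | _, _ => False

/-- `F14 r` is the graph `F₁₄(4r+5)`, on `4r + 5` vertices, used for `r ≥ 1`:
a clique `s 0, ..., s (2r)`, two nonadjacent vertices `q`, `x`, each adjacent to the whole
clique, vertices `v i` adjacent to `s (i-1)` and `s i` for `1 ≤ i ≤ 2r`, a vertex `v 0` adjacent
to `s 0` and `x`, and a vertex `v (2r+1)` adjacent to `s (2r)` and `x`. -/
def F14 (r : ℕ) : SimpleGraph (V13 r) := SimpleGraph.fromRel fun
  | .s _, .s _ => True
  | .q, .s _ => True
  | .x, .s _ => True
  | .v i, .s j => j.val + 1 = i.val ∨ j.val = i.val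
  | .v i, .x => i.val = 0 ∨ i.val = 2 * r + 1
  | _, _ => False

/-- Vertices of `F15 r`. -/
inductive V15 (r : ℕ)
  | q | x | y
  | s (j : Fin (2 * r + 1))
  | v (i : Fin (2 * r + 2))

/-- `F15 r` is the graph `F₁₅(4r+6)`, on `4r + 6` vertices, used for `r ≥ 1`:
a clique `s 0, ..., s (2r)`, two adjacent vertices `x`, `y` and a vertex `q` nonadjacent to them,
all three adjacent to the whole clique, vertices `v i` adjacent to `s (i-1)` and `s i` for
`1 ≤ i ≤ 2r`, a vertex `v 0` adjacent to `s 0` and `x`, and a vertex `v (2r+1)` adjacent to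
`s (2r)` and `y`. -/
def F15 (r : ℕ) : SimpleGraph (V15 r) := SimpleGraph.fromRel fun
  | .s _, .s _ => True
  | .q, .s _ => True
  | .x, .s _ => True
  | .y, .s _ => True
  | .x, .y => True
  | .v i, .s j => j.val + 1 = i.val ∨ j.val = i.val
  | .v i, .x => i.val = 0
  | .v i, .y => i.val = 2 * r + 1
  | _, _ => False

/-- Vertices of `F16 k`. -/
inductive V16 (k : ℕ)
  | a | b
  | s (j : Fin (2 * k))
  | v (i : Fin (2 * k + 1))

/-- `F16 k` is the graph `F₁₆(4k+3)`, on `4k + 3` vertices, used for `k ≥ 2`: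
a clique `s 0, ..., s (2k-1)`, two nonadjacent vertices `a`, `b`, each adjacent to the whole
clique, vertices `v i` adjacent to `s (i-1)` and `s i` for `1 ≤ i ≤ 2k-1`, a vertex `v 0`
adjacent to `a` and `s 0`, and a vertex `v (2k)` adjacent to `s (2k-1)` and `b`. -/
def F16 (k : ℕ) : SimpleGraph (V16 k) := SimpleGraph.fromRel fun
  | .s _, .s _ => True
  | .a, .s _ => True
  | .b, .s _ => True
  | .v i, .s j => j.val + 1 = i.val ∨ j.val = i.val
  | .v i, .a => i.val = 0
  | .v i, .b => i.val = 2 * k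
  | _, _ => False

end PathGraphs

/-! Non-representability rests on two kinds of obstruction, and minimality on explicit models.

In a tree, call `y` between `x` and `z` if every walk from `x` to `z` passes through it. The paths
of the vertices on a walk of `G` have a connected union, so a tree vertex between two points of that
union lies on one of them (`mem_union_of_btw`). With trichotomy on a path and medians in a tree this
excludes asteroidal triples in a neighbourhood (`F1` to `F5`) and holes (`F0`).

The other graphs are excluded by looking at a maximal clique `Q`. By the Helly property its paths
share a tree vertex `t`, and by maximality no other path contains `t`. Hence each vertex outside `Q`
lives in one branch at `t` (its color) and is entered from `t` at one point (its gate). The path of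
a member of `Q` leaves `t` in at most two directions, so the outside neighbours of one clique vertex
use at most two colors, and those of the same color are linearly ordered by distance from `t`; along
this order adjacency to `Q` can only be lost. Thus two outside vertices with a common neighbour in
`Q` and incomparable neighbourhoods in `Q` have different colors. Moreover, if `v` comes between `w`
and `w'` in this order, every walk of `G` from `w` to `w'` meets `v` or a neighbour of it. These
facts, collected in `Branching`, are all that is used. The sporadic graphs and `F10` give three
colors at one clique vertex or a forbidden betweenness; in `F11` to `F16` colors must alternate
along a chain of simplicial vertices, which yields a parity contradiction, or for `F16` again a
forbidden betweenness.

For minimality, it suffices to represent the graph without one vertex `d`, for every `d`.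
Caterpillars are enough: there the intersection of two paths is an arithmetic condition on their
ends (`meets_iff`), which can be decided for the small graphs and proved by linear arithmetic for
the families. In `F11` to `F16`, the deletion gives room for one defect in the alternation of sides,
or for putting all paths through a common spine vertex. -/

namespace PathGraphs

open SimpleGraph

/-! ### Betweenness in trees -/

section Betweenness

variable {X : Type*} {T : SimpleGraph X}

/-- Every walk of `T` from `x` to `z` passes through `y`. -/
def Btw (T : SimpleGraph X) (x y z : X) : Prop := ∀ p : T.Walk x z, y ∈ p.support

/-- `S` contains all the vertices between two of its members. -/
def BtwClosed (T : SimpleGraph X) (S : Set X) : Prop :=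
  ∀ x ∈ S, ∀ z ∈ S, ∀ y, Btw T x y z → y ∈ S

lemma Btw.symm {x y z : X} (h : Btw T x y z) : Btw T z y x := fun p => by
  simpa using h p.reverse

/-- A walk from `t` to `z` reaches `y`, and its initial part up to `y` already contains `x`. -/
lemma Btw.trans_left {t x y z : X} (h : Btw T t x y) (h' : Btw T t y z) : Btw T t x z := fun p => by
  classical
  exact p.support_takeUntil_subset_support (h' p) (h _)

lemma BtwClosed.inter {S S' : Set X} (h : BtwClosed T S) (h' : BtwClosed T S') :
    BtwClosed T (S ∩ S') := fun x hx z hz y hy =>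
  ⟨h x hx.1 z hz.1 y hy, h' x hx.2 z hz.2 y hy⟩

lemma btwClosed_of_walk {S : Set X}
    (h : ∀ x ∈ S, ∀ z ∈ S, ∃ p : T.Walk x z, ∀ y ∈ p.support, y ∈ S) : BtwClosed T S := by
  intro x hx z hz y hy
  obtain ⟨p, hp⟩ := h x hx z hz
  exact hp y (hy p)

lemma exists_walk_of_mem_support {a b x z : X} (p : T.Walk a b) (hx : x ∈ p.support)
    (hz : z ∈ p.support) : ∃ q : T.Walk x z, ∀ y ∈ q.support, y ∈ p.support := by
  classical
  refine ⟨(p.takeUntil x hx).reverse.append (p.takeUntil z hz), fun y hy => ?_⟩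
  rw [Walk.mem_support_append_iff, Walk.support_reverse, List.mem_reverse] at hy
  rcases hy with hy | hy
  · exact p.support_takeUntil_subset_support hx hy
  · exact p.support_takeUntil_subset_support hz hy

lemma btwClosed_support {a b : X} (p : T.Walk a b) : BtwClosed T {x | x ∈ p.support} :=
  btwClosed_of_walk fun _ hx _ hz => exists_walk_of_mem_support p hx hz

/-- The unique path of the tree is what remains of any walk with the same ends after removing its
detours. -/
lemma btw_of_isPath (hT : T.IsTree) {x y z : X} {p : T.Walk x z} (hp : p.IsPath)
    (hy : y ∈ p.support) : Btw T x y z := fun q => by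
  classical
  have h : (⟨p, hp⟩ : T.Path x z) = q.toPath := (hT.isAcyclic.subsingleton_path x z).elim _ _
  have h' : p = q.toPath := congrArg Subtype.val h
  rw [h'] at hy
  exact q.support_bypass_subset_support hy

lemma btw_getVert_iff (hT : T.IsTree) {a b : X} {p : T.Walk a b} (hp : p.IsPath) {i j m : ℕ}
    (hij : i ≤ j) (hj : j ≤ p.length) (hm : m ≤ p.length) :
    Btw T (p.getVert i) (p.getVert m) (p.getVert j) ↔ i ≤ m ∧ m ≤ j := by
  have hend : (p.drop i).getVert (j - i) = p.getVert j := by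
    rw [Walk.drop_getVert]; congr 1; omega
  constructor
  · intro h
    have h1 := h (((p.drop i).take (j - i)).copy rfl hend)
    rw [Walk.support_copy, Walk.mem_support_iff_exists_getVert] at h1
    obtain ⟨n, hn, -⟩ := h1
    rw [Walk.take_getVert, Walk.drop_getVert] at hn
    have := hp.getVert_injOn (by simp only [Set.mem_ofPred_eq]; omega) (by
      simp only [Set.mem_ofPred_eq]; omega) hn
    omega
  · rintro ⟨h1, h2⟩
    refine btw_of_isPath hT (p := ((p.drop i).take (j - i)).copy rfl hend)
      (by simpa using (hp.drop i).take _) ?_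
    rw [Walk.support_copy, Walk.mem_support_iff_exists_getVert]
    refine ⟨m - i, ?_, ?_⟩
    · rw [Walk.take_getVert, Walk.drop_getVert]; congr 1; omega
    · rw [Walk.take_length, Walk.drop_length]; omega

lemma exists_index {a b x : X} {p : T.Walk a b} (hx : x ∈ p.support) :
    ∃ i ≤ p.length, x = p.getVert i := by
  obtain ⟨n, hn, hl⟩ := Walk.mem_support_iff_exists_getVert.mp hx
  exact ⟨n, hl, hn.symm⟩

/-- One of three vertices of a path is between the two others. -/
lemma btw_trichotomy (hT : T.IsTree) {a b x y z : X} {p : T.Walk a b} (hp : p.IsPath)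
    (hx : x ∈ p.support) (hy : y ∈ p.support) (hz : z ∈ p.support) :
    Btw T x y z ∨ Btw T y z x ∨ Btw T z x y := by
  obtain ⟨i, hi, rfl⟩ := exists_index hx
  obtain ⟨j, hj, rfl⟩ := exists_index hy
  obtain ⟨k, hk, rfl⟩ := exists_index hz
  rcases le_total i j with h1 | h1 <;> rcases le_total j k with h2 | h2 <;>
    rcases le_total i k with h3 | h3
  · exact .inl ((btw_getVert_iff hT hp h3 hk hj).2 ⟨h1, h2⟩)
  · exact .inl ((btw_getVert_iff hT hp (h1.trans h2) hk hj).2 ⟨h1, h2⟩)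
  · exact .inr (.inl ((btw_getVert_iff hT hp h1 hj hk).2 ⟨h3, h2⟩).symm)
  · exact .inr (.inr ((btw_getVert_iff hT hp h2 hj hi).2 ⟨h3, h1⟩))
  · exact .inr (.inr ((btw_getVert_iff hT hp h2 hk hi).2 ⟨h1, h3⟩).symm)
  · exact .inr (.inl ((btw_getVert_iff hT hp h1 hi hk).2 ⟨h2, h3⟩))
  · exact .inl ((btw_getVert_iff hT hp (h2.trans h1) hi hj).2 ⟨h2, h1⟩).symm
  · exact .inl ((btw_getVert_iff hT hp h3 hi hj).2 ⟨h2, h1⟩).symm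

/-- A vertex `t` of a path does not separate three others pairwise. -/
lemma not_pairwise_separated (hT : T.IsTree) {a b x y z t : X} {p : T.Walk a b} (hp : p.IsPath)
    (hx : x ∈ p.support) (hy : y ∈ p.support) (hz : z ∈ p.support) (ht : t ∈ p.support)
    (hxt : x ≠ t) (hyt : y ≠ t) (hzt : z ≠ t)
    (hxy : Btw T x t y) (hyz : Btw T y t z) (hxz : Btw T x t z) : False := by
  obtain ⟨i, hi, rfl⟩ := exists_index hx
  obtain ⟨j, hj, rfl⟩ := exists_index hy
  obtain ⟨k, hk, rfl⟩ := exists_index hz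
  obtain ⟨m, hm, rfl⟩ := exists_index ht
  have key : ∀ {i j : ℕ}, i ≤ p.length → j ≤ p.length →
      Btw T (p.getVert i) (p.getVert m) (p.getVert j) → (i ≤ m ∧ m ≤ j) ∨ (j ≤ m ∧ m ≤ i) := by
    intro i j hi hj h
    rcases le_total i j with h1 | h1
    · exact .inl ((btw_getVert_iff hT hp h1 hj hm).1 h)
    · exact .inr ((btw_getVert_iff hT hp h1 hi hm).1 h.symm)
  have h1 := key hi hj hxy
  have h2 := key hj hk hyz
  have h3 := key hi hk hxz
  have hi' : i ≠ m := fun h => hxt (by rw [h])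
  have hj' : j ≠ m := fun h => hyt (by rw [h])
  have hk' : k ≠ m := fun h => hzt (by rw [h])
  omega

lemma exists_isPath (hT : T.IsTree) (x y : X) : ∃ p : T.Walk x y, p.IsPath :=
  (hT.existsUnique_path x y).exists

/-- Both `x` and `y` lie on the path from `t` to `z`, so the claim is a comparison of indices there.
-/
lemma Btw.tail (hT : T.IsTree) {t x y z : X} (h : Btw T t x y) (h' : Btw T t y z) :
    Btw T x y z := by
  obtain ⟨p, hp⟩ := exists_isPath hT t z
  obtain ⟨j, hj, rfl⟩ := exists_index (h' p)
  obtain ⟨i, hi, rfl⟩ := exists_index (h.trans_left h' p)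
  have hij : i ≤ j := ((btw_getVert_iff hT hp (Nat.zero_le j) hj hi).1 (by simpa using h)).2
  simpa using (btw_getVert_iff hT hp hi le_rfl hj).2 ⟨hij, hj⟩

/-- A nonempty subtree has a gate: a vertex through which every walk from `t` into the subtree
passes. -/
lemma exists_gate (hT : T.IsTree) {S : Set X} (hne : S.Nonempty)
    (hS : ∀ x ∈ S, ∀ z ∈ S, ∃ p : T.Walk x z, ∀ y ∈ p.support, y ∈ S) (t : X) :
    ∃ g ∈ S, ∀ y ∈ S, Btw T t g y := by
  classical
  -- The gate is a vertex of `S` nearest to `t`. A shortest path to it meets `S` only at its end, so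
  -- continuing inside `S` to any `y` again gives a path.
  obtain ⟨g, hg, hmin⟩ : ∃ g ∈ S, ∀ y ∈ S, T.dist t g ≤ T.dist t y := by
    exact ⟨_, Function.argminOn_mem (fun y => T.dist t y) S hne, fun y hy =>
      Function.argminOn_le (fun y => T.dist t y) S hy⟩
  refine ⟨g, hg, fun y hy => ?_⟩
  obtain ⟨r, hr, hlen⟩ := hT.connected.exists_path_of_dist t g
  obtain ⟨w, hw⟩ := hS g hg y hy
  have hwS : ∀ z ∈ w.bypass.support, z ∈ S := fun z hz => hw z (w.support_bypass_subset_support hz)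
  have hrS : ∀ z ∈ r.support, z ∈ S → z = g := by
    intro z hz hzS
    by_contra hne
    have h1 := Walk.length_takeUntil_lt_length hz hne
    have h2 := SimpleGraph.dist_le (r.takeUntil z hz)
    have h3 := hmin z hzS
    omega
  have hpath : (r.append w.bypass).IsPath := by
    rw [Walk.isPath_def, Walk.support_append, List.nodup_append]
    have hb : w.bypass.support.Nodup := w.bypass_isPath.support_nodup
    rw [← Walk.cons_tail_support] at hb
    refine ⟨hr.support_nodup, (List.nodup_cons.1 hb).2, ?_⟩
    intro x hx z hz hxz
    subst hxz
    have hxg := hrS x hx (hwS x (List.mem_of_mem_tail hz))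
    subst hxg
    exact (List.nodup_cons.1 hb).1 hz
  exact btw_of_isPath hT hpath (by simp)

/-- The median of three vertices. -/
lemma exists_median (hT : T.IsTree) (x y z : X) :
    ∃ m, Btw T x m y ∧ Btw T x m z ∧ Btw T y m z := by
  obtain ⟨p, hp⟩ := exists_isPath hT y z
  obtain ⟨g, hg, hgate⟩ := exists_gate hT (S := {v | v ∈ p.support}) ⟨y, p.start_mem_support⟩
    (fun _ hx _ hz => exists_walk_of_mem_support p hx hz) x
  exact ⟨g, hgate y p.start_mem_support, hgate z p.end_mem_support, btw_of_isPath hT hp hg⟩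

/-- The Helly property of subtrees. -/
lemma helly (hT : T.IsTree) {ι : Type*} (s : Finset ι) (S : ι → Set X)
    (hS : ∀ i ∈ s, BtwClosed T (S i)) (h : ∀ i ∈ s, ∀ j ∈ s, (S i ∩ S j).Nonempty) :
    ∃ t, ∀ i ∈ s, t ∈ S i := by
  classical
  induction s using Finset.induction_on generalizing S with
  | empty => exact ⟨hT.connected.nonempty.some, by simp⟩
  | insert a s ha ih =>
    rcases s.eq_empty_or_nonempty with rfl | ⟨c, hc⟩
    · obtain ⟨t, ht⟩ := h a (by simp) a (by simp)
      exact ⟨t, by simpa using ht.1⟩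
    · have haS := Finset.mem_insert_self a s
      have hsub : ∀ {i}, i ∈ s → i ∈ insert a s := fun h => Finset.mem_insert_of_mem h
      -- The induction hypothesis is applied to the traces on `S a`. They still meet pairwise: the
      -- median of points chosen in the three pairwise intersections lies in all three sets.
      obtain ⟨t, ht⟩ := ih (fun i => S i ∩ S a)
        (fun i hi => (hS i (hsub hi)).inter (hS a haS)) (by
          intro i hi j hj
          obtain ⟨x, hx⟩ := h i (hsub hi) j (hsub hj)
          obtain ⟨y, hy⟩ := h i (hsub hi) a haS
          obtain ⟨z, hz⟩ := h j (hsub hj) a haS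
          obtain ⟨m, h1, h2, h3⟩ := exists_median hT x y z
          exact ⟨m, ⟨hS i (hsub hi) x hx.1 y hy.1 m h1, hS a haS y hy.2 z hz.2 m h3⟩,
            hS j (hsub hj) x hx.2 z hz.1 m h2, hS a haS y hy.2 z hz.2 m h3⟩)
      refine ⟨t, fun i hi => ?_⟩
      rcases Finset.mem_insert.1 hi with rfl | hi
      · exact (ht c hc).2
      · exact (ht i hi).1

end Betweenness

/-! ### Necessary conditions for path graphs -/

section Necessary

variable {V : Type*} {G : SimpleGraph V} {m : ℕ} {T : SimpleGraph (Fin m)} {a b : V → Fin m}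
  {P : ∀ v, T.Path (a v) (b v)}

/-- Consecutive vertices of `p` have paths with a common tree vertex, where walks inside these paths
can be joined. -/
lemma exists_walk_in_union
    (hP : ∀ u v, u ≠ v → (G.Adj u v ↔ ∃ x, x ∈ (P u).1.support ∧ x ∈ (P v).1.support))
    {u v : V} (p : G.Walk u v) {x z : Fin m} (hx : x ∈ (P u).1.support)
    (hz : z ∈ (P v).1.support) :
    ∃ q : T.Walk x z, ∀ y ∈ q.support, ∃ w ∈ p.support, y ∈ (P w).1.support := by
  induction p generalizing x with
  | nil =>
    obtain ⟨q, hq⟩ := exists_walk_of_mem_support _ hx hz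
    exact ⟨q, fun y hy => ⟨_, by simp, hq y hy⟩⟩
  | cons h p ih =>
    obtain ⟨c, hc, hc'⟩ := (hP _ _ h.ne).1 h
    obtain ⟨q, hq⟩ := exists_walk_of_mem_support _ hx hc
    obtain ⟨q', hq'⟩ := ih hc' hz
    refine ⟨q.append q', fun y hy => ?_⟩
    rw [Walk.mem_support_append_iff] at hy
    rcases hy with hy | hy
    · exact ⟨_, Walk.start_mem_support _, hq y hy⟩
    · obtain ⟨w, hw, hyw⟩ := hq' y hy
      exact ⟨w, by simp [hw], hyw⟩

lemma mem_union_of_btw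
    (hP : ∀ u v, u ≠ v → (G.Adj u v ↔ ∃ x, x ∈ (P u).1.support ∧ x ∈ (P v).1.support))
    {u v : V} (p : G.Walk u v) {x y z : Fin m} (hx : x ∈ (P u).1.support)
    (hz : z ∈ (P v).1.support) (h : Btw T x y z) : ∃ w ∈ p.support, y ∈ (P w).1.support := by
  obtain ⟨q, hq⟩ := exists_walk_in_union hP p hx hz
  exact hq y (h q)

/-- The neighbourhood of a vertex of a path graph contains no asteroidal triple. -/
theorem not_isPathGraph_of_asteroidal {u x y z : V} (hx : G.Adj u x) (hy : G.Adj u y)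
    (hz : G.Adj u z) (p : G.Walk x y) (hp : ∀ w ∈ p.support, w ≠ z ∧ ¬ G.Adj w z)
    (q : G.Walk y z) (hq : ∀ w ∈ q.support, w ≠ x ∧ ¬ G.Adj w x)
    (r : G.Walk z x) (hr : ∀ w ∈ r.support, w ≠ y ∧ ¬ G.Adj w y) : ¬ IsPathGraph G := by
  rintro ⟨m, T, a, b, P, hT, hP⟩
  obtain ⟨i, hi, hi'⟩ := (hP _ _ hx.ne).1 hx
  obtain ⟨j, hj, hj'⟩ := (hP _ _ hy.ne).1 hy
  obtain ⟨k, hk, hk'⟩ := (hP _ _ hz.ne).1 hz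
  -- If `k` were between `i` and `j`, some path of a vertex on the walk from `x` to `y` would
  -- contain `k`, although that walk avoids `z` and its neighbours. But `i`, `j`, `k` all lie on the
  -- path of `u`, so one of them is between the others.
  have key : ∀ {x y z : V} {i j k : Fin m} (p : G.Walk x y),
      (∀ w ∈ p.support, w ≠ z ∧ ¬ G.Adj w z) → i ∈ (P x).1.support → j ∈ (P y).1.support →
      k ∈ (P z).1.support → ¬ Btw T i k j := by
    intro x y z i j k p hp hi hj hk hb
    obtain ⟨w, hw, hkw⟩ := mem_union_of_btw hP p hi hj hb
    exact (hp w hw).2 ((hP _ _ (hp w hw).1).2 ⟨k, hkw, hk⟩)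
  rcases btw_trichotomy hT (P u).2 hi hj hk with h | h | h
  · exact key r hr hk' hi' hj' h.symm
  · exact key p hp hi' hj' hk' h.symm
  · exact key q hq hj' hk' hi' h.symm

/-- In a path graph, a walk from a neighbour of `u` to a neighbour of `v` that avoids the edge
`u v` contains a common neighbour of `u` and `v`. -/
theorem exists_common_adj_of_walk (h : IsPathGraph G) {u v x y : V} (huv : G.Adj u v)
    (hx : G.Adj u x) (hy : G.Adj v y) (p : G.Walk x y) (hu : u ∉ p.support) (hv : v ∉ p.support) :
    ∃ w ∈ p.support, G.Adj u w ∧ G.Adj v w := by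
  obtain ⟨m, T, a, b, P, hT, hP⟩ := h
  obtain ⟨i, hi, hi'⟩ := (hP _ _ huv.ne).1 huv
  obtain ⟨j, hj, hj'⟩ := (hP _ _ hx.ne).1 hx
  obtain ⟨k, hk, hk'⟩ := (hP _ _ hy.ne).1 hy
  -- The median is on the path of `u` (between `i` and `j`), on that of `v` (between `i` and `k`),
  -- and on that of some vertex of the walk (between `j` and `k`).
  obtain ⟨c, h1, h2, h3⟩ := exists_median hT i j k
  obtain ⟨w, hw, hcw⟩ := mem_union_of_btw hP p hj' hk' h3
  exact ⟨w, hw, (hP u w fun h => hu (h ▸ hw)).2 ⟨c, btwClosed_support _ _ hi _ hj _ h1, hcw⟩,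
    (hP v w fun h => hv (h ▸ hw)).2 ⟨c, btwClosed_support _ _ hi' _ hk _ h2, hcw⟩⟩

/-- How the vertices outside a clique `Q` represented at a vertex `t` of the tree are distributed
over the branches at `t`: `color v` is the branch of `v`, and `le v w` says that the path of `v` is
reached from `t` before the path of `w`. -/
structure Branching (G : SimpleGraph V) (Q : V → Prop) where
  /-- The branches. -/
  Color : Type
  /-- The branch of a vertex. -/
  color : V → Color
  /-- The order of the vertices in a branch. -/
  le : V → V → Prop
  color_eq_of_adj : ∀ {v w}, ¬ Q v → ¬ Q w → G.Adj v w → color v = color w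
  two_colors : ∀ {z u v w}, Q z → ¬ Q u → ¬ Q v → ¬ Q w → G.Adj z u → G.Adj z v → G.Adj z w →
    color u = color v ∨ color v = color w ∨ color u = color w
  comparable : ∀ {z v w}, Q z → ¬ Q v → ¬ Q w → G.Adj z v → G.Adj z w → color v = color w →
    le v w ∨ le w v
  adj_of_le : ∀ {z v w}, Q z → ¬ Q v → ¬ Q w → le v w → G.Adj z w → G.Adj z v
  not_le_le : ∀ {v w w'} (p : G.Walk w w'), (∀ x ∈ p.support, x ≠ v ∧ ¬ G.Adj x v) →
    le w v → ¬ le v w'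

/-- Every maximal clique of a finite path graph has a branching. -/
theorem IsPathGraph.nonempty_branching [Finite V] (h : IsPathGraph G) (Q : V → Prop)
    (hQ : ∀ u v, Q u → Q v → u ≠ v → G.Adj u v) (hmax : ∀ v, ¬ Q v → ∃ u, Q u ∧ ¬ G.Adj v u) :
    Nonempty (Branching G Q) := by
  obtain ⟨m, T, a, b, P, hT, hP⟩ := h
  obtain ⟨t, ht⟩ := helly hT (Set.toFinite {v | Q v}).toFinset
    (fun v => {x | x ∈ (P v).1.support}) (fun v _ => btwClosed_support _) (by
      intro u hu v hv
      rw [Set.Finite.mem_toFinset, Set.mem_ofPred_eq] at hu hv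
      by_cases huv : u = v
      · subst huv
        exact ⟨a u, by simp⟩
      · obtain ⟨x, hx, hx'⟩ := (hP u v huv).1 (hQ u v hu hv huv)
        exact ⟨x, hx, hx'⟩)
  simp only [Set.Finite.mem_toFinset, Set.mem_ofPred_eq] at ht
  have htn : ∀ v, ¬ Q v → t ∉ (P v).1.support := by
    intro v hv htv
    obtain ⟨u, hu, huv⟩ := hmax v hv
    exact huv ((hP v u fun h => hv (h ▸ hu)).2 ⟨t, htv, ht u hu⟩)
  have hgate : ∀ v, ∃ g ∈ (P v).1.support, ∀ y ∈ (P v).1.support, Btw T t g y := fun v =>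
    exists_gate hT (S := {x | x ∈ (P v).1.support}) ⟨a v, by simp⟩
      (fun _ hx _ hz => exists_walk_of_mem_support _ hx hz) t
  choose g hg hgt using hgate
  have hgne : ∀ v, ¬ Q v → g v ≠ t := fun v hv h => htn v hv (h ▸ hg v)
  -- The path of `z` contains `t` and some vertex of the path of `v`, hence also the gate between
  -- them.
  have hmem : ∀ z, Q z → ∀ v, ¬ Q v → G.Adj z v → g v ∈ (P z).1.support := by
    intro z hz v hv hzv
    obtain ⟨y, hy, hy'⟩ := (hP z v hzv.ne).1 hzv
    exact btwClosed_support _ _ (ht z hz) _ hy _ (hgt v y hy')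
  -- The set `{x | ¬ Btw T (g v) t x}` is the component of `g v` in the tree without `t`; different
  -- components are separated by `t`.
  have hsep : ∀ v w, ¬ Q v → ¬ Q w →
      {x | ¬ Btw T (g v) t x} ≠ {x | ¬ Btw T (g w) t x} → Btw T (g v) t (g w) := by
    intro v w hv hw hne
    by_contra hb
    refine hne (Set.ext fun x => ?_)
    simp only [Btw, not_forall] at hb
    obtain ⟨q, hq⟩ := hb
    simp only [Set.mem_ofPred_eq, Btw, not_forall]
    constructor
    · rintro ⟨r, hr⟩
      refine ⟨q.reverse.append r, ?_⟩
      simp [Walk.mem_support_append_iff, hq, hr]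
    · rintro ⟨r, hr⟩
      refine ⟨q.append r, ?_⟩
      simp [Walk.mem_support_append_iff, hq, hr]
  refine ⟨⟨Set (Fin m), fun v => {x | ¬ Btw T (g v) t x}, fun v w => Btw T t (g v) (g w),
    ?_, ?_, ?_, ?_, ?_⟩⟩
  · intro v w hv hw hvw
    by_contra hne
    obtain ⟨u, hu, hu'⟩ :=
      mem_union_of_btw hP (Walk.cons hvw Walk.nil) (hg v) (hg w) (hsep v w hv hw hne)
    simp only [Walk.support_cons, Walk.support_nil, List.mem_cons, List.not_mem_nil,
      or_false] at hu
    rcases hu with rfl | rfl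
    · exact htn _ hv hu'
    · exact htn _ hw hu'
  · intro z u v w hz hu hv hw hzu hzv hzw
    by_contra! hne
    exact not_pairwise_separated hT (P z).2 (hmem z hz u hu hzu) (hmem z hz v hv hzv)
      (hmem z hz w hw hzw) (ht z hz) (hgne u hu) (hgne v hv) (hgne w hw)
      (hsep u v hu hv hne.1) (hsep v w hv hw hne.2.1) (hsep u w hu hw hne.2.2)
  · intro z v w hz hv hw hzv hzw hc
    rcases btw_trichotomy hT (P z).2 (ht z hz) (hmem z hz v hv hzv) (hmem z hz w hw hzw)
      with h | h | h
    · exact .inl h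
    · exact .inr h.symm
    -- The remaining order, with `t` between the two gates, would put them in different components.
    · have h1 : g w ∈ {x | ¬ Btw T (g w) t x} := fun hb => by
        have := hb Walk.nil
        simp only [Walk.support_nil, List.mem_cons, List.not_mem_nil, or_false] at this
        exact hgne w hw this.symm
      have hc' : {x | ¬ Btw T (g v) t x} = {x | ¬ Btw T (g w) t x} := hc
      rw [← hc'] at h1
      exact absurd h.symm h1
  · intro z v w hz hv hw hle hzw
    exact (hP z v fun h => hv (h ▸ hz)).2
      ⟨g v, btwClosed_support _ _ (ht z hz) _ (hmem z hz w hw hzw) _ hle, hg v⟩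
  · intro v w w' p hp h1 h2
    -- By `Btw.tail` the gate of `v` is between those of `w` and `w'`, so a path of a vertex of `p`
    -- contains it.
    obtain ⟨x, hx, hx'⟩ := mem_union_of_btw hP p (hg w) (hg w') (h1.tail hT h2)
    exact (hp x hx).2 ((hP x v (hp x hx).1).2 ⟨g v, hx', hg v⟩)

namespace Branching

variable {Q : V → Prop} (B : Branching G Q)

/-- Two vertices with a common neighbour in the clique and incomparable neighbourhoods there are
in different branches. -/
lemma color_ne {v w : V} (hv : ¬ Q v) (hw : ¬ Q w) (z z₁ z₂ : V) (hz : Q z) (h₁ : Q z₁) (h₂ : Q z₂)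
    (hzv : G.Adj z v) (hzw : G.Adj z w) (h₁v : G.Adj z₁ v) (h₁w : ¬ G.Adj z₁ w)
    (h₂w : G.Adj z₂ w) (h₂v : ¬ G.Adj z₂ v) : B.color v ≠ B.color w := fun h =>
  (B.comparable hz hv hw hzv hzw h).elim (fun hle => h₂v (B.adj_of_le h₂ hv hw hle h₂w))
    fun hle => h₁w (B.adj_of_le h₁ hw hv hle h₁v)

/-- If `w` and `v` have a common neighbour in the clique, and `v` has a neighbour there that `w`
does not have, then `v` comes before `w`. -/
lemma le_of_adj {v w : V} (hv : ¬ Q v) (hw : ¬ Q w) (z z' : V) (hz : Q z) (hz' : Q z')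
    (hzv : G.Adj z v) (hzw : G.Adj z w) (hv' : G.Adj z' v) (hw' : ¬ G.Adj z' w)
    (h : B.color v = B.color w) : B.le v w :=
  (B.comparable hz hv hw hzv hzw h).resolve_right fun hle =>
    hw' (B.adj_of_le hz' hw hv hle hv')

end Branching

end Necessary

/-! ### Caterpillar representations -/

section Caterpillar

/-- The graph of a parent function whose iterates lead to `root` is a tree. -/
lemma isTree_fromRel_parent {X : Type*} [Finite X] (root : X) (parent : X → X) (rank : X → ℕ)
    (h : ∀ x, x ≠ root → rank (parent x) < rank x) :
    (SimpleGraph.fromRel fun x y => x ≠ root ∧ y = parent x).IsTree := by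
  classical
  have hadj : ∀ x, x ≠ root →
      (SimpleGraph.fromRel fun x y => x ≠ root ∧ y = parent x).Adj x (parent x) := by
    intro x hx
    rw [SimpleGraph.fromRel_adj]
    exact ⟨fun hxp => (h x hx).ne (by rw [← hxp]), .inl ⟨hx, rfl⟩⟩
  have hreach : ∀ n x, rank x ≤ n →
      (SimpleGraph.fromRel fun x y => x ≠ root ∧ y = parent x).Reachable x root := by
    intro n
    induction n with
    | zero =>
      intro x hx
      by_cases hxr : x = root
      · rw [hxr]
      · have := h x hxr
        omega
    | succ n ih =>
      intro x hx
      by_cases hxr : x = root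
      · rw [hxr]
      · have := h x hxr
        exact (hadj x hxr).reachable.trans (ih _ (by omega))
  have hconn : (SimpleGraph.fromRel fun x y => x ≠ root ∧ y = parent x).Connected :=
    (SimpleGraph.connected_iff_exists_forall_reachable _).2
      ⟨root, fun x => (hreach _ x le_rfl).symm⟩
  -- Connectedness bounds the number of edges from below. For the upper bound, every edge joins some
  -- `x ≠ root` to its parent.
  refine SimpleGraph.isTree_iff_connected_and_card.2 ⟨hconn, ?_⟩
  refine le_antisymm ?_ hconn.card_vert_le_card_edgeSet_add_one
  have hsub : (SimpleGraph.fromRel fun x y => x ≠ root ∧ y = parent x).edgeSet ⊆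
      (fun x => s(x, parent x)) '' {root}ᶜ := by
    intro e
    induction e with
    | _ x y =>
      rw [SimpleGraph.mem_edgeSet, SimpleGraph.fromRel_adj]
      rintro ⟨-, ⟨hx, rfl⟩ | ⟨hy, rfl⟩⟩
      · exact ⟨x, hx, rfl⟩
      · exact ⟨y, hy, Sym2.eq_swap⟩
  have h1 := Set.ncard_le_ncard hsub (Set.toFinite _)
  have h2 := Set.ncard_image_le (f := fun x => s(x, parent x)) (Set.toFinite ({root}ᶜ : Set X))
  have h3 := Set.ncard_add_ncard_compl ({root} : Set X)
  rw [Set.ncard_singleton] at h3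
  rw [Nat.card_coe_set_eq]
  omega

/-- The caterpillar with spine `(0, 0), (1, 0), ...` and leaves `(i, e)`, `e ≠ 0`, attached to
`(i, 0)`. -/
def caterpillar (N : ℕ) : SimpleGraph (Fin (N + 1) × Fin (N + 1)) :=
  SimpleGraph.fromRel fun x y => x ≠ 0 ∧
    y = if x.2 = 0 then (⟨x.1.val - 1, by omega⟩, 0) else (x.1, 0)

lemma caterpillar_isTree (N : ℕ) : (caterpillar N).IsTree := by
  refine isTree_fromRel_parent 0
    (fun x : Fin (N + 1) × Fin (N + 1) => if x.2 = 0 then (⟨x.1.val - 1, by omega⟩, 0) else (x.1, 0))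
    (fun x => x.1.val + x.2.val) ?_
  rintro ⟨i, e⟩ hx
  by_cases he : e = 0
  · have hi : i ≠ 0 := fun hi => hx (by rw [hi, he]; rfl)
    have : i.val ≠ 0 := fun h => hi (Fin.ext h)
    simp only [he, if_true, Fin.val_zero]
    omega
  · have : e.val ≠ 0 := fun h => he (Fin.ext h)
    simp only [he, if_false, Fin.val_zero]
    omega

lemma caterpillar_adj_leaf {N : ℕ} (i : Fin (N + 1)) {e : Fin (N + 1)} (he : e ≠ 0) :
    (caterpillar N).Adj (i, e) (i, 0) := by
  rw [caterpillar, SimpleGraph.fromRel_adj]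
  exact ⟨by simpa using he, .inl ⟨fun h => he (congrArg Prod.snd h), by simp [he]⟩⟩

lemma caterpillar_adj_spine {N : ℕ} {i j : Fin (N + 1)} (h : i.val + 1 = j.val) :
    (caterpillar N).Adj (i, 0) (j, 0) := by
  rw [caterpillar, SimpleGraph.fromRel_adj]
  refine ⟨fun hij => ?_, .inr ⟨fun hj => ?_, ?_⟩⟩
  · have := congrArg Fin.val (congrArg Prod.fst hij)
    simp only at this
    omega
  · have : j.val = 0 := congrArg Fin.val (congrArg Prod.fst hj)
    omega
  · ext <;> simp
    omega

/-- `x` is on the path from `A` to `B` in a caterpillar. -/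
def OnSegment (A B x : ℕ × ℕ) : Prop :=
  x = A ∨ x = B ∨ (A ≠ B ∧ x.2 = 0 ∧ min A.1 B.1 ≤ x.1 ∧ x.1 ≤ max A.1 B.1)

/-- The vertex of a caterpillar, as a pair of numbers. -/
def coords {N : ℕ} (x : Fin (N + 1) × Fin (N + 1)) : ℕ × ℕ := (x.1.val, x.2.val)

lemma coords_injective {N : ℕ} : Function.Injective (coords (N := N)) := by
  rintro ⟨i, e⟩ ⟨j, f⟩ h
  simp only [coords, Prod.mk.injEq] at h
  exact Prod.ext (Fin.ext h.1) (Fin.ext h.2)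

lemma exists_spine_path {N : ℕ} (d : ℕ) (i j : Fin (N + 1)) (h : i.val + d = j.val) :
    ∃ p : (caterpillar N).Walk (i, 0) (j, 0), p.IsPath ∧
      ∀ x, x ∈ p.support ↔ x.2 = 0 ∧ i.val ≤ x.1.val ∧ x.1.val ≤ j.val := by
  induction d generalizing j with
  | zero =>
    obtain rfl : i = j := Fin.ext (by simpa using h)
    refine ⟨Walk.nil, Walk.IsPath.nil, ?_⟩
    rintro ⟨k, e⟩
    simp only [Walk.support_nil, List.mem_singleton, Prod.mk.injEq, Fin.ext_iff]
    omega
  | succ d ih =>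
    have hj : j.val - 1 < N + 1 := by omega
    obtain ⟨p, hp, hs⟩ := ih ⟨j.val - 1, hj⟩ (by simp only; omega)
    have hadj := caterpillar_adj_spine (N := N) (i := ⟨j.val - 1, hj⟩) (j := j)
      (by simp only; omega)
    refine ⟨p.concat hadj, hp.concat (fun hmem => ?_) hadj, ?_⟩
    · have := ((hs _).1 hmem).2.2
      simp only at this
      omega
    · rintro ⟨k, e⟩
      simp only [Walk.support_concat, List.mem_append, hs,
        List.mem_singleton, Prod.mk.injEq, Fin.ext_iff]
      omega

lemma exists_path_of_le {N : ℕ} (A B : Fin (N + 1) × Fin (N + 1)) (h : A.1 ≤ B.1) :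
    ∃ p : (caterpillar N).Walk A B, p.IsPath ∧
      ∀ x, x ∈ p.support ↔ OnSegment (coords A) (coords B) (coords x) := by
  obtain ⟨i, e⟩ := A
  obtain ⟨j, f⟩ := B
  have hij : i.val ≤ j.val := h
  by_cases hAB : (i, e) = (j, f)
  · obtain ⟨rfl, rfl⟩ := Prod.mk.inj hAB
    refine ⟨Walk.nil, Walk.IsPath.nil, fun x => ?_⟩
    simp [OnSegment, coords_injective.eq_iff]
  obtain ⟨p, hp, hs⟩ := exists_spine_path (j.val - i.val) i j (by omega)
  obtain ⟨q, hq, hqs⟩ : ∃ q : (caterpillar N).Walk (i, e) (j, 0), q.IsPath ∧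
      ∀ x, x ∈ q.support ↔ x = (i, e) ∨ x.2 = 0 ∧ i.val ≤ x.1.val ∧ x.1.val ≤ j.val := by
    by_cases he : e = 0
    · subst he
      refine ⟨p, hp, fun x => ?_⟩
      rw [hs]
      refine ⟨.inr, ?_⟩
      rintro (rfl | h)
      · exact ⟨rfl, le_rfl, hij⟩
      · exact h
    · refine ⟨Walk.cons (caterpillar_adj_leaf i he) p, hp.cons fun hmem => he ((hs _).1 hmem).1, ?_⟩
      intro x
      simp [hs]
  obtain ⟨r, hr, hrs⟩ : ∃ r : (caterpillar N).Walk (i, e) (j, f), r.IsPath ∧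
      ∀ x, x ∈ r.support ↔
        x = (i, e) ∨ x = (j, f) ∨ x.2 = 0 ∧ i.val ≤ x.1.val ∧ x.1.val ≤ j.val := by
    by_cases hf : f = 0
    · subst hf
      refine ⟨q, hq, fun x => ?_⟩
      rw [hqs]
      constructor
      · tauto
      · rintro (h | rfl | h)
        · exact .inl h
        · exact .inr ⟨rfl, hij, le_rfl⟩
        · exact .inr h
    · refine ⟨q.concat (caterpillar_adj_leaf j hf).symm, hq.concat (fun hmem => ?_) _, ?_⟩
      · rcases (hqs _).1 hmem with h | h
        · exact hAB h.symm
        · exact hf h.1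
      · intro x
        simp only [Walk.support_concat, List.mem_append, hqs,
          List.mem_singleton]
        tauto
  refine ⟨r, hr, fun x => ?_⟩
  rw [hrs, OnSegment, coords_injective.eq_iff, coords_injective.eq_iff, Ne,
    coords_injective.eq_iff]
  simp only [hAB, not_false_eq_true, true_and, coords, Fin.ext_iff, Fin.val_zero]
  rw [min_eq_left hij, max_eq_right hij]

lemma OnSegment.swap {A B x : ℕ × ℕ} : OnSegment A B x ↔ OnSegment B A x := by
  unfold OnSegment
  rw [min_comm, max_comm, ne_comm]
  tauto

lemma exists_path {N : ℕ} (A B : Fin (N + 1) × Fin (N + 1)) :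
    ∃ p : (caterpillar N).Path A B,
      ∀ x, x ∈ p.1.support ↔ OnSegment (coords A) (coords B) (coords x) := by
  rcases le_total A.1 B.1 with h | h
  · obtain ⟨p, hp, hs⟩ := exists_path_of_le A B h
    exact ⟨⟨p, hp⟩, hs⟩
  · obtain ⟨p, hp, hs⟩ := exists_path_of_le B A h
    refine ⟨⟨p.reverse, hp.reverse⟩, fun x => ?_⟩
    rw [Walk.support_reverse, List.mem_reverse, hs, OnSegment.swap]

/-- The paths of a caterpillar with ends `p.1`, `p.2` and `q.1`, `q.2` have a common vertex. -/
def Meets (p q : (ℕ × ℕ) × (ℕ × ℕ)) : Prop :=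
  p.1 = q.1 ∨ p.1 = q.2 ∨ p.2 = q.1 ∨ p.2 = q.2 ∨
    ((p.1 ≠ p.2 ∨ p.1.2 = 0) ∧ (q.1 ≠ q.2 ∨ q.1.2 = 0) ∧
      min p.1.1 p.2.1 ≤ max q.1.1 q.2.1 ∧ min q.1.1 q.2.1 ≤ max p.1.1 p.2.1)

instance (p q : (ℕ × ℕ) × (ℕ × ℕ)) : Decidable (Meets p q) := by
  unfold Meets
  infer_instance

/-- A common vertex is an end of both paths or lies on the spine. A path has a spine vertex unless
it is a single leaf, which is what `p.1 ≠ p.2 ∨ p.1.2 = 0` says; its spine part is then an interval,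
and two overlapping intervals share the larger of their left ends. -/
lemma meets_iff (p q : (ℕ × ℕ) × (ℕ × ℕ)) :
    Meets p q ↔ ∃ x, OnSegment p.1 p.2 x ∧ OnSegment q.1 q.2 x := by
  obtain ⟨A, B⟩ := p
  obtain ⟨A', B'⟩ := q
  dsimp only [Meets]
  constructor
  · rintro (h | h | h | h | ⟨h1, h2, h3, h4⟩)
    · exact ⟨A, .inl rfl, .inl h⟩
    · exact ⟨A, .inl rfl, .inr (.inl h)⟩
    · exact ⟨B, .inr (.inl rfl), .inl h⟩
    · exact ⟨B, .inr (.inl rfl), .inr (.inl h)⟩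
    · have key : ∀ {C D : ℕ × ℕ} {k : ℕ}, (C ≠ D ∨ C.2 = 0) → min C.1 D.1 ≤ k →
          k ≤ max C.1 D.1 → OnSegment C D (k, 0) := by
        intro C D k h hk hk'
        by_cases hCD : C = D
        · subst hCD
          refine .inl (Prod.ext ?_ ?_)
          · simp only
            omega
          · simpa [eq_comm] using h
        · exact .inr (.inr ⟨hCD, rfl, hk, hk'⟩)
      exact ⟨(max (min A.1 B.1) (min A'.1 B'.1), 0), key h1 (by omega) (by omega),
        key h2 (by omega) (by omega)⟩
  · have key : ∀ {C D : ℕ × ℕ}, C.2 = 0 → (C ≠ D ∨ C.2 = 0) := fun h => .inr h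
    have key' : ∀ {C D : ℕ × ℕ}, D.2 = 0 → (C ≠ D ∨ C.2 = 0) := by
      intro C D h
      by_cases hCD : C = D
      · exact .inr (hCD ▸ h)
      · exact .inl hCD
    rintro ⟨x, hx, hx'⟩
    dsimp only [OnSegment] at hx hx'
    rcases hx with rfl | rfl | ⟨h1, h2, h3, h4⟩ <;> rcases hx' with h | h | ⟨h5, h6, h7, h8⟩
    · exact .inl h
    · exact .inr (.inl h)
    · exact .inr (.inr (.inr (.inr ⟨key h6, .inl h5, by omega, by omega⟩)))
    · exact .inr (.inr (.inl h))
    · exact .inr (.inr (.inr (.inl h)))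
    · exact .inr (.inr (.inr (.inr ⟨key' h6, .inl h5, by omega, by omega⟩)))
    · exact .inr (.inr (.inr (.inr ⟨.inl h1, key (h ▸ h2), by subst h; omega,
        by subst h; omega⟩)))
    · exact .inr (.inr (.inr (.inr ⟨.inl h1, key' (h ▸ h2), by subst h; omega,
        by subst h; omega⟩)))
    · exact .inr (.inr (.inr (.inr ⟨.inl h1, .inl h5, by omega,
        by omega⟩)))

/-- A finite graph represented by paths of a caterpillar is a path graph. -/
theorem isPathGraph_of_meets {V : Type*} [Finite V] {G : SimpleGraph V}
    (f : V → (ℕ × ℕ) × (ℕ × ℕ)) (h : ∀ u v, u ≠ v → (G.Adj u v ↔ Meets (f u) (f v))) :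
    IsPathGraph G := by
  obtain ⟨N, hN⟩ : ∃ N, ∀ v, (f v).1.1 ≤ N ∧ (f v).1.2 ≤ N ∧ (f v).2.1 ≤ N ∧ (f v).2.2 ≤ N := by
    obtain ⟨N, hN⟩ := (Set.finite_range fun v =>
      (f v).1.1 + (f v).1.2 + (f v).2.1 + (f v).2.2).bddAbove
    refine ⟨N, fun v => ?_⟩
    have : (f v).1.1 + (f v).1.2 + (f v).2.1 + (f v).2.2 ≤ N := hN ⟨v, rfl⟩
    omega
  have hex : ∀ v, ∃ (A B : Fin (N + 1) × Fin (N + 1)) (p : (caterpillar N).Path A B),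
      ∀ x, x ∈ p.1.support ↔ OnSegment (f v).1 (f v).2 (coords x) := by
    intro v
    obtain ⟨h1, h2, h3, h4⟩ := hN v
    obtain ⟨p, hp⟩ := exists_path (N := N)
      (⟨(f v).1.1, by omega⟩, ⟨(f v).1.2, by omega⟩) (⟨(f v).2.1, by omega⟩, ⟨(f v).2.2, by omega⟩)
    exact ⟨_, _, p, hp⟩
  choose A B p hp using hex
  -- `IsPathGraph` asks for a tree on some `Fin m`, so the caterpillar is transported along this
  -- bijection.
  let e : Fin (N + 1) × Fin (N + 1) ≃ Fin ((N + 1) * (N + 1)) := finProdFinEquiv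
  let φ : caterpillar N ≃g (caterpillar N).map e.toEmbedding := SimpleGraph.Iso.map e _
  refine ⟨(N + 1) * (N + 1), (caterpillar N).map e.toEmbedding, fun v => φ (A v),
    fun v => φ (B v), fun v => (p v).map φ.toHom φ.injective, φ.isTree_iff.1 (caterpillar_isTree N),
    fun u v huv => ?_⟩
  rw [h u v huv, meets_iff]
  have hsupp : ∀ w y, y ∈ ((p w).map φ.toHom φ.injective).1.support ↔
      ∃ x, x ∈ (p w).1.support ∧ φ x = y := by
    intro w y
    change y ∈ ((p w).1.map φ.toHom).support ↔ _
    rw [Walk.support_map, List.mem_map]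
    rfl
  constructor
  · rintro ⟨x, hx, hx'⟩
    -- A point of a segment is no farther out than the ends, so it is a vertex of the bounded
    -- caterpillar.
    have hb : x.1 ≤ N ∧ x.2 ≤ N := by
      obtain ⟨h1, h2, h3, h4⟩ := hN u
      rcases hx with rfl | rfl | ⟨-, h5, h6, h7⟩
      · exact ⟨h1, h2⟩
      · exact ⟨h3, h4⟩
      · omega
    let y : Fin (N + 1) × Fin (N + 1) := (⟨x.1, by omega⟩, ⟨x.2, by omega⟩)
    exact ⟨φ y, (hsupp u _).2 ⟨y, (hp u y).2 hx, rfl⟩, (hsupp v _).2 ⟨y, (hp v y).2 hx', rfl⟩⟩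
  · rintro ⟨y, hy, hy'⟩
    obtain ⟨x, hx, rfl⟩ := (hsupp u y).1 hy
    obtain ⟨x', hx', hxx'⟩ := (hsupp v _).1 hy'
    obtain rfl := φ.injective hxx'
    exact ⟨coords x', (hp u _).1 hx, (hp v _).1 hx'⟩

/-- A non-path graph is minimal if the deletion of any vertex leaves a graph represented by
paths of a caterpillar. -/
theorem isMinimalNonPathGraph_of_meets {V : Type*} [Finite V] {G : SimpleGraph V}
    (hG : ¬ IsPathGraph G)
    (h : ∀ d : V, ∃ f : V → (ℕ × ℕ) × (ℕ × ℕ), ∀ u v, u ≠ d → v ≠ d → u ≠ v →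
      (G.Adj u v ↔ Meets (f u) (f v))) : IsMinimalNonPathGraph G := by
  refine ⟨hG, fun s hs => ?_⟩
  obtain ⟨d, hd⟩ := (Set.ne_univ_iff_exists_notMem s).1 hs
  obtain ⟨f, hf⟩ := h d
  refine isPathGraph_of_meets (fun v => f v.1) fun u v huv => ?_
  rw [SimpleGraph.comap_adj]
  exact hf u v (fun h => hd (h ▸ u.2)) (fun h => hd (h ▸ v.2)) fun h => huv (Subtype.ext h)

end Caterpillar

/-! ### The small graphs -/

/-- The ends of a path in a caterpillar, where `10 * i + e` stands for the vertex `(i, e)`. -/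
def decodeEnds (p : ℕ × ℕ) : (ℕ × ℕ) × (ℕ × ℕ) := ((p.1 / 10, p.1 % 10), (p.2 / 10, p.2 % 10))

/-- Row `d` of the table is a model of the graph without `d`; its entry at `d` itself is a
placeholder. -/
lemma isMinimalNonPathGraph_of_table {n : ℕ} {G : SimpleGraph (Fin n)} [DecidableRel G.Adj]
    (hG : ¬ IsPathGraph G) (table : Fin n → Fin n → ℕ × ℕ)
    (h : ∀ d u v, u ≠ d → v ≠ d → u ≠ v →
      (G.Adj u v ↔ Meets (decodeEnds (table d u)) (decodeEnds (table d v)))) :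
    IsMinimalNonPathGraph G :=
  isMinimalNonPathGraph_of_meets hG fun d => ⟨fun u => decodeEnds (table d u), h d⟩

instance : DecidableRel F1.Adj := by unfold F1; infer_instance

instance : DecidableRel F2.Adj := by unfold F2; infer_instance

instance : DecidableRel F3.Adj := by unfold F3; infer_instance

instance : DecidableRel F4.Adj := by unfold F4; infer_instance

instance : DecidableRel F6.Adj := by unfold F6; infer_instance

instance : DecidableRel F7.Adj := by unfold F7; infer_instance

instance : DecidableRel F8.Adj := by unfold F8; infer_instance

instance : DecidableRel F9.Adj := by unfold F9; infer_instance

/-- The leaves of the bipartite claw are an asteroidal triple in the neighbourhood of the universal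
vertex; `F2`, `F3` and `F4` follow the same pattern. -/
lemma not_isPathGraph_F1 : ¬ IsPathGraph F1 :=
  not_isPathGraph_of_asteroidal (u := 7) (x := 4) (y := 5) (z := 6)
    (by decide) (by decide) (by decide)
    (.cons (v := 1) (by decide) (.cons (v := 0) (by decide) (.cons (v := 2) (by decide) (.cons (v := 5) (by decide) .nil)))) (by decide)
    (.cons (v := 2) (by decide) (.cons (v := 0) (by decide) (.cons (v := 3) (by decide) (.cons (v := 6) (by decide) .nil)))) (by decide)
    (.cons (v := 3) (by decide) (.cons (v := 0) (by decide) (.cons (v := 1) (by decide) (.cons (v := 4) (by decide) .nil)))) (by decide)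

lemma not_isPathGraph_F2 : ¬ IsPathGraph F2 :=
  not_isPathGraph_of_asteroidal (u := 6) (x := 3) (y := 4) (z := 5)
    (by decide) (by decide) (by decide)
    (.cons (v := 1) (by decide) (.cons (v := 4) (by decide) .nil)) (by decide)
    (.cons (v := 2) (by decide) (.cons (v := 5) (by decide) .nil)) (by decide)
    (.cons (v := 0) (by decide) (.cons (v := 3) (by decide) .nil)) (by decide)

lemma not_isPathGraph_F3 : ¬ IsPathGraph F3 :=
  not_isPathGraph_of_asteroidal (u := 7) (x := 2) (y := 5) (z := 6)
    (by decide) (by decide) (by decide)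
    (.cons (v := 3) (by decide) (.cons (v := 4) (by decide) (.cons (v := 5) (by decide) .nil))) (by decide)
    (.cons (v := 1) (by decide) (.cons (v := 6) (by decide) .nil)) (by decide)
    (.cons (v := 0) (by decide) (.cons (v := 2) (by decide) .nil)) (by decide)

lemma not_isPathGraph_F4 : ¬ IsPathGraph F4 :=
  not_isPathGraph_of_asteroidal (u := 7) (x := 0) (y := 4) (z := 6)
    (by decide) (by decide) (by decide)
    (.cons (v := 5) (by decide) (.cons (v := 4) (by decide) .nil)) (by decide)
    (.cons (v := 3) (by decide) (.cons (v := 2) (by decide) (.cons (v := 6) (by decide) .nil))) (by decide)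
    (.cons (v := 2) (by decide) (.cons (v := 1) (by decide) (.cons (v := 0) (by decide) .nil))) (by decide)

theorem isMinimalNonPathGraph_F1 : IsMinimalNonPathGraph F1 :=
  isMinimalNonPathGraph_of_table not_isPathGraph_F1
    ![![(0, 0), (10, 10), (0, 0), (20, 20), (10, 10), (0, 0), (20, 20), (0, 20)],
      ![(10, 20), (0, 0), (20, 30), (0, 10), (40, 40), (30, 30), (0, 0), (0, 40)],
      ![(10, 20), (0, 10), (0, 0), (20, 30), (0, 0), (40, 40), (30, 30), (0, 40)],
      ![(10, 20), (0, 10), (20, 30), (0, 0), (0, 0), (30, 30), (40, 40), (0, 40)],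
      ![(10, 30), (20, 20), (0, 10), (30, 40), (0, 0), (0, 0), (40, 40), (0, 40)],
      ![(10, 30), (0, 10), (20, 20), (30, 40), (0, 0), (0, 0), (40, 40), (0, 40)],
      ![(10, 30), (0, 10), (30, 40), (20, 20), (0, 0), (40, 40), (0, 0), (0, 40)],
      ![(10, 30), (20, 21), (0, 10), (30, 40), (21, 21), (0, 0), (40, 40), (0, 0)]]
    (by decide)

theorem isMinimalNonPathGraph_F2 : IsMinimalNonPathGraph F2 :=
  isMinimalNonPathGraph_of_table not_isPathGraph_F2
    ![![(0, 0), (0, 10), (10, 20), (0, 0), (10, 10), (20, 20), (0, 20)],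
      ![(0, 10), (0, 0), (10, 20), (0, 0), (20, 20), (10, 10), (0, 20)],
      ![(10, 20), (0, 10), (0, 0), (10, 10), (0, 0), (20, 20), (0, 20)],
      ![(10, 20), (0, 10), (0, 20), (0, 0), (0, 0), (20, 20), (0, 20)],
      ![(0, 20), (0, 10), (10, 20), (0, 0), (0, 0), (20, 20), (0, 20)],
      ![(0, 10), (0, 20), (10, 20), (0, 0), (20, 20), (0, 0), (0, 20)],
      ![(11, 20), (0, 11), (0, 20), (11, 11), (0, 0), (20, 20), (0, 0)]]
    (by decide)

theorem isMinimalNonPathGraph_F3 : IsMinimalNonPathGraph F3 :=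
  isMinimalNonPathGraph_of_table not_isPathGraph_F3
    ![![(0, 0), (10, 30), (0, 0), (0, 10), (10, 20), (20, 20), (30, 30), (0, 30)],
      ![(0, 20), (0, 0), (10, 10), (10, 20), (20, 30), (30, 30), (0, 0), (0, 30)],
      ![(10, 20), (0, 20), (0, 0), (10, 10), (0, 10), (0, 0), (20, 20), (0, 20)],
      ![(0, 20), (10, 30), (0, 0), (0, 0), (20, 30), (30, 30), (10, 10), (0, 30)],
      ![(0, 20), (10, 30), (0, 0), (0, 10), (0, 0), (30, 30), (20, 20), (0, 30)],
      ![(0, 20), (10, 20), (0, 0), (0, 10), (10, 10), (0, 0), (20, 20), (0, 20)],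
      ![(0, 10), (10, 20), (0, 0), (0, 10), (10, 20), (20, 20), (0, 0), (0, 20)],
      ![(11, 20), (0, 20), (11, 11), (10, 11), (0, 10), (0, 0), (20, 20), (0, 0)]]
    (by decide)

theorem isMinimalNonPathGraph_F4 : IsMinimalNonPathGraph F4 :=
  isMinimalNonPathGraph_of_table not_isPathGraph_F4
    ![![(0, 0), (10, 10), (0, 20), (20, 30), (30, 30), (10, 30), (0, 0), (0, 30)],
      ![(0, 0), (0, 0), (20, 30), (10, 20), (10, 10), (0, 20), (30, 30), (0, 30)],
      ![(10, 10), (10, 10), (0, 0), (0, 0), (0, 0), (0, 10), (20, 20), (0, 20)],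
      ![(10, 10), (10, 20), (20, 30), (0, 0), (0, 0), (0, 20), (30, 30), (0, 30)],
      ![(0, 0), (0, 10), (10, 30), (20, 20), (0, 0), (0, 20), (30, 30), (0, 30)],
      ![(0, 0), (0, 10), (10, 30), (30, 40), (40, 40), (0, 0), (20, 20), (0, 40)],
      ![(0, 0), (0, 10), (10, 20), (20, 30), (30, 30), (0, 30), (0, 0), (0, 30)],
      ![(11, 11), (10, 11), (0, 20), (20, 30), (30, 30), (11, 30), (0, 0), (0, 0)]]
    (by decide)

/-- At clique vertex `0`, vertex `5` is incomparable to `3` and to `4`, so `3` and `4` share a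
branch, which also contains `6` and `7`. If `3` comes before `4`, then `4` is between the adjacent
vertices `3` and `6` without being adjacent to either; the other order is excluded by `4`, `7` and
`3`. -/
lemma not_isPathGraph_F6 : ¬ IsPathGraph F6 := fun h => by
  obtain ⟨B⟩ := h.nonempty_branching (fun v => v ∈ [0, 1, 2]) (by decide) (by decide)
  have h53 : B.color 5 ≠ B.color 3 := B.color_ne (by decide) (by decide) 0 2 1
    (by decide) (by decide) (by decide) (by decide) (by decide) (by decide) (by decide)
    (by decide) (by decide)
  have h54 : B.color 5 ≠ B.color 4 := B.color_ne (by decide) (by decide) 0 2 1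
    (by decide) (by decide) (by decide) (by decide) (by decide) (by decide) (by decide)
    (by decide) (by decide)
  have h34 : B.color 3 = B.color 4 := by
    have := B.two_colors (z := 0) (u := 5) (v := 3) (w := 4) (by decide) (by decide) (by decide)
      (by decide) (by decide) (by decide) (by decide)
    tauto
  have h36 : B.color 3 = B.color 6 := B.color_eq_of_adj (by decide) (by decide) (by decide)
  have h47 : B.color 4 = B.color 7 := B.color_eq_of_adj (by decide) (by decide) (by decide)
  have hle46 : B.le 4 6 := B.le_of_adj (by decide) (by decide) 0 1 (by decide) (by decide)
    (by decide) (by decide) (by decide) (by decide) (h34.symm.trans h36)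
  have hle37 : B.le 3 7 := B.le_of_adj (by decide) (by decide) 1 0 (by decide) (by decide)
    (by decide) (by decide) (by decide) (by decide) (h34.trans h47)
  rcases B.comparable (z := 0) (v := 3) (w := 4) (by decide) (by decide) (by decide) (by decide)
    (by decide) h34 with hle | hle
  · exact B.not_le_le (Walk.cons (u := 3) (v := 6) (by decide) Walk.nil) (by decide) hle hle46
  · exact B.not_le_le (Walk.cons (u := 4) (v := 7) (by decide) Walk.nil) (by decide) hle hle37

/-- As for `F6`: here `6` forces `4` and `5` into one branch, and their neighbours `7` and `8`
exclude either order. -/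
lemma not_isPathGraph_F7 : ¬ IsPathGraph F7 := fun h => by
  obtain ⟨B⟩ := h.nonempty_branching (fun v => v ∈ [0, 1, 2, 3]) (by decide) (by decide)
  have h64 : B.color 6 ≠ B.color 4 := B.color_ne (by decide) (by decide) 0 3 1
    (by decide) (by decide) (by decide) (by decide) (by decide) (by decide) (by decide)
    (by decide) (by decide)
  have h65 : B.color 6 ≠ B.color 5 := B.color_ne (by decide) (by decide) 0 3 1
    (by decide) (by decide) (by decide) (by decide) (by decide) (by decide) (by decide)
    (by decide) (by decide)
  have h45 : B.color 4 = B.color 5 := by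
    have := B.two_colors (z := 0) (u := 6) (v := 4) (w := 5) (by decide) (by decide) (by decide)
      (by decide) (by decide) (by decide) (by decide)
    tauto
  have h47 : B.color 4 = B.color 7 := B.color_eq_of_adj (by decide) (by decide) (by decide)
  have h58 : B.color 5 = B.color 8 := B.color_eq_of_adj (by decide) (by decide) (by decide)
  have hle57 : B.le 5 7 := B.le_of_adj (by decide) (by decide) 1 0 (by decide) (by decide)
    (by decide) (by decide) (by decide) (by decide) (h45.symm.trans h47)
  have hle48 : B.le 4 8 := B.le_of_adj (by decide) (by decide) 2 0 (by decide) (by decide)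
    (by decide) (by decide) (by decide) (by decide) (h45.trans h58)
  rcases B.comparable (z := 0) (v := 4) (w := 5) (by decide) (by decide) (by decide) (by decide)
    (by decide) h45 with hle | hle
  · exact B.not_le_le (Walk.cons (u := 4) (v := 7) (by decide) Walk.nil) (by decide) hle hle57
  · exact B.not_le_le (Walk.cons (u := 5) (v := 8) (by decide) Walk.nil) (by decide) hle hle48

/-- Three colors at clique vertex `0`: those of `5`, `6` and `4`. The vertices `4` and `5` are
comparable in the clique; they are told apart through `7`, which shares the branch of `4`. -/
lemma not_isPathGraph_F8 : ¬ IsPathGraph F8 := fun h => by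
  obtain ⟨B⟩ := h.nonempty_branching (fun v => v ∈ [0, 1, 2, 3]) (by decide) (by decide)
  have h56 : B.color 5 ≠ B.color 6 := B.color_ne (by decide) (by decide) 0 1 2
    (by decide) (by decide) (by decide) (by decide) (by decide) (by decide) (by decide)
    (by decide) (by decide)
  have h64 : B.color 6 ≠ B.color 4 := B.color_ne (by decide) (by decide) 0 3 1
    (by decide) (by decide) (by decide) (by decide) (by decide) (by decide) (by decide)
    (by decide) (by decide)
  have h57 : B.color 5 ≠ B.color 7 := B.color_ne (by decide) (by decide) 1 0 2
    (by decide) (by decide) (by decide) (by decide) (by decide) (by decide) (by decide)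
    (by decide) (by decide)
  have h47 : B.color 4 = B.color 7 := B.color_eq_of_adj (by decide) (by decide) (by decide)
  have := B.two_colors (z := 0) (u := 5) (v := 6) (w := 4) (by decide) (by decide) (by decide)
    (by decide) (by decide) (by decide) (by decide)
  rw [← h47] at h57
  tauto

/-- Three colors at clique vertex `1`: those of `7`, `5` and `3`, where `5` and `3` are told apart
through the neighbour `6` of `3`. The clique contains `4` rather than `3`. -/
lemma not_isPathGraph_F9 : ¬ IsPathGraph F9 := fun h => by
  obtain ⟨B⟩ := h.nonempty_branching (fun v => v ∈ [0, 1, 2, 4]) (by decide) (by decide)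
  have h75 : B.color 7 ≠ B.color 5 := B.color_ne (by decide) (by decide) 1 4 0
    (by decide) (by decide) (by decide) (by decide) (by decide) (by decide) (by decide)
    (by decide) (by decide)
  have h73 : B.color 7 ≠ B.color 3 := B.color_ne (by decide) (by decide) 1 4 0
    (by decide) (by decide) (by decide) (by decide) (by decide) (by decide) (by decide)
    (by decide) (by decide)
  have h56 : B.color 5 ≠ B.color 6 := B.color_ne (by decide) (by decide) 0 1 2
    (by decide) (by decide) (by decide) (by decide) (by decide) (by decide) (by decide)
    (by decide) (by decide)
  have h36 : B.color 3 = B.color 6 := B.color_eq_of_adj (by decide) (by decide) (by decide)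
  have := B.two_colors (z := 1) (u := 7) (v := 5) (w := 3) (by decide) (by decide) (by decide)
    (by decide) (by decide) (by decide) (by decide)
  rw [← h36] at h56
  tauto

theorem isMinimalNonPathGraph_F6 : IsMinimalNonPathGraph F6 :=
  isMinimalNonPathGraph_of_table not_isPathGraph_F6
    ![![(0, 0), (0, 20), (10, 11), (20, 30), (0, 0), (11, 11), (30, 30), (0, 0)],
      ![(0, 11), (0, 0), (11, 11), (0, 0), (10, 20), (11, 11), (0, 0), (20, 20)],
      ![(0, 21), (10, 30), (0, 0), (0, 10), (20, 30), (21, 21), (0, 0), (30, 30)],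
      ![(0, 21), (10, 30), (0, 10), (0, 0), (20, 30), (0, 0), (21, 21), (30, 30)],
      ![(11, 30), (0, 20), (10, 11), (20, 30), (0, 0), (11, 11), (30, 30), (0, 0)],
      ![(0, 30), (10, 40), (20, 20), (0, 10), (30, 40), (0, 0), (0, 0), (40, 40)],
      ![(0, 30), (10, 40), (0, 10), (20, 20), (30, 40), (0, 0), (0, 0), (40, 40)],
      ![(0, 40), (10, 30), (0, 10), (30, 40), (20, 20), (0, 0), (40, 40), (0, 0)]]
    (by decide)

theorem isMinimalNonPathGraph_F7 : IsMinimalNonPathGraph F7 :=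
  isMinimalNonPathGraph_of_table not_isPathGraph_F7
    ![![(0, 0), (0, 30), (10, 40), (20, 21), (0, 10), (30, 40), (21, 21), (0, 0), (40, 40)],
      ![(0, 30), (0, 0), (10, 40), (0, 10), (20, 21), (30, 40), (0, 0), (21, 21), (40, 40)],
      ![(0, 30), (10, 40), (0, 0), (0, 10), (30, 40), (20, 21), (0, 0), (40, 40), (21, 21)],
      ![(11, 20), (0, 20), (10, 30), (0, 0), (0, 10), (20, 30), (11, 11), (0, 0), (30, 30)],
      ![(11, 20), (0, 20), (10, 30), (10, 11), (0, 0), (20, 30), (11, 11), (0, 0), (30, 30)],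
      ![(11, 20), (10, 30), (0, 20), (10, 11), (20, 30), (0, 0), (11, 11), (30, 30), (0, 0)],
      ![(10, 30), (0, 30), (10, 40), (20, 20), (0, 10), (30, 40), (0, 0), (0, 0), (40, 40)],
      ![(0, 30), (10, 30), (10, 40), (0, 10), (20, 20), (30, 40), (0, 0), (0, 0), (40, 40)],
      ![(0, 30), (10, 40), (10, 30), (0, 10), (30, 40), (20, 20), (0, 0), (40, 40), (0, 0)]]
    (by decide)

theorem isMinimalNonPathGraph_F8 : IsMinimalNonPathGraph F8 :=
  isMinimalNonPathGraph_of_table not_isPathGraph_F8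
    ![![(0, 0), (11, 20), (0, 20), (0, 10), (20, 20), (11, 11), (0, 0), (20, 20)],
      ![(0, 11), (0, 0), (0, 20), (0, 0), (10, 20), (11, 11), (0, 0), (20, 20)],
      ![(0, 30), (10, 40), (0, 0), (0, 10), (30, 40), (20, 20), (0, 0), (40, 40)],
      ![(0, 11), (11, 20), (0, 20), (0, 0), (10, 20), (11, 11), (0, 0), (20, 20)],
      ![(0, 11), (11, 20), (0, 20), (0, 10), (0, 0), (11, 11), (0, 0), (20, 20)],
      ![(0, 20), (10, 30), (0, 30), (0, 10), (20, 30), (0, 0), (0, 0), (30, 30)],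
      ![(0, 20), (0, 30), (10, 30), (10, 10), (20, 30), (0, 0), (0, 0), (30, 30)],
      ![(0, 30), (10, 30), (0, 20), (0, 10), (20, 20), (30, 30), (0, 0), (0, 0)]]
    (by decide)

theorem isMinimalNonPathGraph_F9 : IsMinimalNonPathGraph F9 :=
  isMinimalNonPathGraph_of_table not_isPathGraph_F9
    ![![(0, 0), (11, 30), (0, 20), (0, 10), (20, 30), (11, 11), (0, 0), (30, 30)],
      ![(0, 11), (0, 0), (0, 10), (0, 0), (10, 20), (11, 11), (0, 0), (20, 20)],
      ![(0, 30), (10, 40), (0, 0), (0, 10), (30, 40), (20, 20), (0, 0), (40, 40)],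
      ![(0, 11), (11, 20), (0, 10), (0, 0), (10, 20), (11, 11), (0, 0), (20, 20)],
      ![(0, 11), (11, 20), (0, 10), (0, 10), (0, 0), (11, 11), (0, 0), (20, 20)],
      ![(0, 20), (10, 30), (0, 20), (0, 10), (20, 30), (0, 0), (0, 0), (30, 30)],
      ![(0, 20), (0, 30), (10, 20), (10, 10), (20, 30), (0, 0), (0, 0), (30, 30)],
      ![(0, 30), (10, 30), (0, 20), (0, 10), (20, 20), (30, 30), (0, 0), (0, 0)]]
    (by decide)

/-! ### Holes and the families around a chordless path -/

lemma exists_walk_of_chain {V : Type*} {G : SimpleGraph V} {n : ℕ} (f : Fin n → V)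
    (hf : ∀ i j : Fin n, i.val + 1 = j.val → G.Adj (f i) (f j)) (d : ℕ) (i j : Fin n)
    (h : i.val + d = j.val) :
    ∃ p : G.Walk (f i) (f j), ∀ v ∈ p.support, ∃ k, i ≤ k ∧ k ≤ j ∧ v = f k := by
  induction d generalizing j with
  | zero =>
    obtain rfl : i = j := Fin.ext (by simpa using h)
    exact ⟨Walk.nil, fun v hv => ⟨i, le_rfl, le_rfl, by simpa using hv⟩⟩
  | succ d ih =>
    have hj : j.val - 1 < n := by omega
    obtain ⟨p, hp⟩ := ih ⟨j.val - 1, hj⟩ (by simp only; omega)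
    have hadj := hf ⟨j.val - 1, hj⟩ j (by simp only; omega)
    refine ⟨p.concat hadj, fun v hv => ?_⟩
    rw [Walk.support_concat, List.mem_append, List.mem_singleton] at hv
    rcases hv with hv | rfl
    · obtain ⟨k, h1, h2, rfl⟩ := hp v hv
      rw [Fin.le_def] at h2
      exact ⟨k, h1, by rw [Fin.le_def]; simp only at h2; omega, rfl⟩
    · exact ⟨j, by rw [Fin.le_def]; omega, le_rfl, rfl⟩

lemma Branching.color_eq_of_walk {V : Type*} {G : SimpleGraph V} {Q : V → Prop}
    (B : Branching G Q) {v w : V} (p : G.Walk v w) (hp : ∀ x ∈ p.support, ¬ Q x) :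
    B.color v = B.color w := by
  induction p with
  | nil => rfl
  | cons h p ih =>
    exact (B.color_eq_of_adj (hp _ (by simp)) (hp _ (by simp)) h).trans
      (ih fun x hx => hp x (by simp [hx]))

lemma F0_adj {n : ℕ} (hn : 3 ≤ n) (u v : Fin n) : (F0 n).Adj u v ↔
    u.val + 1 = v.val ∨ v.val + 1 = u.val ∨ (u.val = 0 ∧ v.val + 1 = n) ∨
      (v.val = 0 ∧ u.val + 1 = n) := by
  rw [F0, cycleGraph_adj']
  have hsub : ∀ u v : Fin n, (u - v).val = if v ≤ u then u.val - v.val else n + u.val - v.val := by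
    intro u v
    split_ifs with h
    · exact Fin.coe_sub_iff_le.2 h
    · exact Fin.coe_sub_iff_lt.2 (not_le.1 h)
  rw [hsub, hsub]
  simp only [Fin.le_def]
  split_ifs <;> omega

theorem isMinimalNonPathGraph_F0 {n : ℕ} (hn : 4 ≤ n) : IsMinimalNonPathGraph (F0 n) := by
  have hadj := F0_adj (n := n) (by omega)
  refine isMinimalNonPathGraph_of_meets (fun h => ?_) fun d => ?_
  · obtain ⟨p, hp⟩ := exists_walk_of_chain (G := F0 n) id
      (fun i j hij => (hadj _ _).2 (.inl hij)) (n - 3) ⟨2, by omega⟩ ⟨n - 1, by omega⟩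
      (by simp only; omega)
    have hp' : ∀ v ∈ p.support, 2 ≤ v.val := by
      intro v hv
      obtain ⟨k, h1, -, rfl⟩ := hp v hv
      exact h1
    -- The rest of the cycle is a walk from a neighbour of `1` to a neighbour of `0`, but `0` and
    -- `1` have no common neighbour when `n ≥ 4`.
    obtain ⟨w, hw, h1, h2⟩ := exists_common_adj_of_walk h (u := (⟨1, by omega⟩ : Fin n))
      (v := ⟨0, by omega⟩) ((hadj _ _).2 (by simp)) ((hadj _ _).2 (by simp))
      ((hadj _ _).2 (.inr (.inr (.inl ⟨rfl, by simp only [id_eq]; omega⟩)))) p (fun h => by simpa using hp' _ h)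
      (fun h => by simpa using hp' _ h)
    have := hp' w hw
    have := w.isLt
    rw [hadj] at h1 h2
    simp only at h1 h2
    omega
  -- The remaining path is numbered cyclically from `d` on, and its `k`-th vertex becomes the
  -- interval from `k` to `k + 1`.
  · refine ⟨fun w => (((if d < w then w.val - d.val else w.val + n - d.val), 0),
      ((if d < w then w.val - d.val else w.val + n - d.val) + 1, 0)), fun u v hu hv huv => ?_⟩
    rw [hadj]
    simp only [Meets, Fin.lt_def, Prod.mk.injEq, ne_eq, Fin.ext_iff] at *
    split_ifs <;> omega

instance (r : ℕ) : Finite (V5 r) :=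
  Finite.of_surjective (fun o : Option (Option (Option (Fin (r + 2)))) => match o with
    | none => V5.u
    | some none => V5.c
    | some (some none) => V5.q
    | some (some (some i)) => V5.x i) fun v => match v with
    | .u => ⟨none, rfl⟩
    | .c => ⟨some none, rfl⟩
    | .q => ⟨some (some none), rfl⟩
    | .x i => ⟨some (some (some i)), rfl⟩

instance (r : ℕ) : Finite (V10 r) :=
  Finite.of_surjective (fun o : Option (Option (Option (Fin (r + 2)))) => match o with
    | none => V10.a
    | some none => V10.b
    | some (some none) => V10.q
    | some (some (some i)) => V10.x i) fun v => match v with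
    | .a => ⟨none, rfl⟩
    | .b => ⟨some none, rfl⟩
    | .q => ⟨some (some none), rfl⟩
    | .x i => ⟨some (some (some i)), rfl⟩

/-- The ends of the chordless path and `q` are asteroidal: the path avoids the neighbourhood of `q`,
and the walks from `q` through `c` enter the path next to the end they aim for. -/
lemma not_isPathGraph_F5 {r : ℕ} (hr : 2 ≤ r) : ¬ IsPathGraph (F5 r) := by
  obtain ⟨p, hp⟩ := exists_walk_of_chain (G := F5 r) V5.x
    (fun i j hij => by simp [F5, Fin.ext_iff]; omega) (r + 1) 0 (Fin.last (r + 1)) (by simp)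
  have hu : ∀ v, v ≠ .u → (F5 r).Adj .u v := fun v hv => by simp [F5, hv.symm]
  have hqc : (F5 r).Adj .q .c := by simp [F5]
  have hc1 : (F5 r).Adj .c (.x ⟨1, by omega⟩) := by simp [F5]; omega
  have hcr : (F5 r).Adj .c (.x ⟨r, by omega⟩) := by simp [F5]; omega
  have h10 : (F5 r).Adj (.x ⟨1, by omega⟩) (.x 0) := by simp [F5]
  have hrl : (F5 r).Adj (.x ⟨r, by omega⟩) (.x (Fin.last (r + 1))) := by simp [F5, Fin.ext_iff]
  refine not_isPathGraph_of_asteroidal (hu (.x 0) (by simp)) (hu (.x (Fin.last (r + 1))) (by simp))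
    (hu .q (by simp)) p ?_ (.cons hrl.symm (.cons hcr.symm (.cons hqc.symm .nil))) ?_
    (.cons hqc (.cons hc1 (.cons h10 .nil))) ?_
  · intro w hw
    obtain ⟨k, -, -, rfl⟩ := hp w hw
    simp [F5]
  · intro w hw
    simp only [Walk.support_cons, Walk.support_nil, List.mem_cons, List.not_mem_nil,
      or_false] at hw
    rcases hw with rfl | rfl | rfl | rfl <;> simp [F5, Fin.ext_iff] <;> omega
  · intro w hw
    simp only [Walk.support_cons, Walk.support_nil, List.mem_cons, List.not_mem_nil,
      or_false] at hw
    rcases hw with rfl | rfl | rfl | rfl <;> simp [F5, Fin.ext_iff] <;> omega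

theorem isMinimalNonPathGraph_F5 {r : ℕ} (hr : 2 ≤ r) : IsMinimalNonPathGraph (F5 r) := by
  refine isMinimalNonPathGraph_of_meets (not_isPathGraph_F5 hr) fun d => ?_
  rcases d with _ | _ | _ | j
  -- Without `u` the spine carries the chordless path; `c` covers the positions from `2` to `r`, and
  -- `q` hangs on the leaf where `c` ends.
  · refine ⟨fun
      | .u => ((0, 0), (0, 0))
      | .c => ((2, 1), (r, 0))
      | .q => ((2, 1), (2, 1))
      | .x i => ((i.val, 0), (i.val + 1, 0)), ?_⟩
    rintro (_ | _ | _ | ⟨i, hi⟩) (_ | _ | _ | ⟨i', hi'⟩) hu hv huv <;>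
      simp [F5, Meets] at * <;> omega
  · refine ⟨fun
      | .u => ((0, 0), (r + 4, 0))
      | .c => ((0, 0), (0, 0))
      | .q => ((r + 4, 0), (r + 4, 0))
      | .x i => ((i.val, 0), (i.val + 1, 0)), ?_⟩
    rintro (_ | _ | _ | ⟨i, hi⟩) (_ | _ | _ | ⟨i', hi'⟩) hu hv huv <;>
      simp [F5, Meets] at * <;> omega
  · refine ⟨fun
      | .u => ((0, 0), (r + 4, 0))
      | .c => ((2, 0), (r, 0))
      | .q => ((0, 0), (0, 0))
      | .x i => ((i.val, 0), (i.val + 1, 0)), ?_⟩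
    rintro (_ | _ | _ | ⟨i, hi⟩) (_ | _ | _ | ⟨i', hi'⟩) hu hv huv <;>
      simp [F5, Meets] at * <;> omega
  -- Deleting `x j` cuts the path. The later part is shifted by `2`, and `q` is put into the gap,
  -- where only `c` and `u` pass.
  · refine ⟨fun
      | .u => ((0, 0), (r + 4, 0))
      | .c => ((2, 0), (r + 2, 0))
      | .q => ((j.val + 1, 0), (j.val + 2, 0))
      | .x i => (((if i ≤ j then i.val else i.val + 2), 0),
          ((if i ≤ j then i.val else i.val + 2) + 1, 0)), ?_⟩
    obtain ⟨j, hj⟩ := j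
    rintro (_ | _ | _ | ⟨i, hi⟩) (_ | _ | _ | ⟨i', hi'⟩) hu hv huv <;>
      simp [F5, Meets] at * <;> (try split_ifs) <;> omega

/-- At `a`, the vertex `x 0` is incomparable to `q` and to `x 3`, so these two share a branch, which
contains the whole path from `x 3` to `x (r+1)`. There `x 3` comes before `q` and `q` before `x
(r+1)`, although no vertex of that path is adjacent to `q`. -/
lemma not_isPathGraph_F10 {r : ℕ} (hr : 3 ≤ r) : ¬ IsPathGraph (F10 r) := fun h => by
  obtain ⟨B⟩ := h.nonempty_branching
    (fun | .a => True | .b => True | .q => False | .x i => i.val = 1 ∨ i.val = 2)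
    (by
      rintro (_ | _ | _ | ⟨i, hi⟩) (_ | _ | _ | ⟨j, hj⟩) hu hv huv <;> simp [F10] at * <;> omega)
    (by
      rintro (_ | _ | _ | ⟨i, hi⟩) hv
      · simp at hv
      · simp at hv
      · exact ⟨.x ⟨1, by omega⟩, by simp [F10]⟩
      · by_cases h0 : i = 0
        · exact ⟨.b, by simp, by simp [F10, h0]⟩
        · refine ⟨.x ⟨1, by omega⟩, by simp, ?_⟩
          simp [F10] at *
          omega)
  have hchain : ∀ i j : Fin (r + 2), i.val + 1 = j.val → (F10 r).Adj (.x i) (.x j) :=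
    fun i j hij => by simp [F10, Fin.ext_iff]; omega
  have h03 : B.color (.x 0) ≠ B.color (.x ⟨3, by omega⟩) :=
    B.color_ne (by simp) (by simp) .a (.x ⟨1, by omega⟩) .b (by simp) (by simp) (by simp)
      (by simp [F10]) (by simp [F10]; omega) (by simp [F10]) (by simp [F10]) (by simp [F10])
      (by simp [F10])
  have hq0 : B.color .q ≠ B.color (.x 0) :=
    B.color_ne (by simp) (by simp) .a .b (.x ⟨1, by omega⟩) (by simp) (by simp) (by simp)
      (by simp [F10]) (by simp [F10]) (by simp [F10]) (by simp [F10]) (by simp [F10])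
      (by simp [F10])
  have hq3 : B.color .q = B.color (.x ⟨3, by omega⟩) := by
    have := B.two_colors (z := .a) (u := .q) (v := .x 0) (w := .x ⟨3, by omega⟩) (by simp)
      (by simp) (by simp) (by simp) (by simp [F10]) (by simp [F10]) (by simp [F10]; omega)
    tauto
  obtain ⟨p, hp⟩ := exists_walk_of_chain V10.x hchain (r - 2) ⟨3, by omega⟩
    ⟨r + 1, by omega⟩ (by simp only; omega)
  have hcol : B.color (.x ⟨3, by omega⟩) = B.color (.x ⟨r + 1, by omega⟩) := by
    refine B.color_eq_of_walk p fun v hv => ?_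
    obtain ⟨k, h1, -, rfl⟩ := hp v hv
    rw [Fin.le_def] at h1
    simp only at h1 ⊢
    omega
  have h1 : B.le (.x ⟨3, by omega⟩) .q :=
    B.le_of_adj (by simp) (by simp) .a (.x ⟨2, by omega⟩) (by simp) (by simp)
      (by simp [F10]; omega) (by simp [F10]) (by simp [F10]) (by simp [F10]) hq3.symm
  have h2 : B.le .q (.x ⟨r + 1, by omega⟩) :=
    B.le_of_adj (by simp) (by simp; omega) .b .a (by simp) (by simp)
      (by simp [F10]) (by simp [F10]) (by simp [F10]) (by simp [F10]) (hq3.trans hcol)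
  refine B.not_le_le p (fun v hv => ?_) h1 h2
  obtain ⟨k, -, -, rfl⟩ := hp v hv
  simp [F10]

theorem isMinimalNonPathGraph_F10 {r : ℕ} (hr : 3 ≤ r) : IsMinimalNonPathGraph (F10 r) := by
  refine isMinimalNonPathGraph_of_meets (not_isPathGraph_F10 hr) fun d => ?_
  rcases d with _ | _ | _ | j
  · refine ⟨fun
      | .a => ((0, 0), (0, 0))
      | .b => ((2, 0), (r + 4, 0))
      | .q => ((r + 4, 0), (r + 4, 0))
      | .x i => ((i.val, 0), (i.val + 1, 0)), ?_⟩
    rintro (_ | _ | _ | ⟨i, hi⟩) (_ | _ | _ | ⟨i', hi'⟩) hu hv huv <;>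
      simp [F10, Meets] at * <;> omega
  · refine ⟨fun
      | .a => ((0, 0), (r + 1, 0))
      | .b => ((0, 0), (0, 0))
      | .q => ((0, 0), (0, 0))
      | .x i => ((i.val + 1, 0), (i.val + 2, 0)), ?_⟩
    rintro (_ | _ | _ | ⟨i, hi⟩) (_ | _ | _ | ⟨i', hi'⟩) hu hv huv <;>
      simp [F10, Meets] at * <;> omega
  · refine ⟨fun
      | .a => ((0, 0), (r, 0))
      | .b => ((2, 0), (r + 2, 0))
      | .q => ((0, 0), (0, 0))
      | .x i => ((i.val, 0), (i.val + 1, 0)), ?_⟩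
    rintro (_ | _ | _ | ⟨i, hi⟩) (_ | _ | _ | ⟨i', hi'⟩) hu hv huv <;>
      simp [F10, Meets] at * <;> omega
  -- As for `F5`, `q` fills the gap left by `x j`, now inside both `a` and `b`.
  · refine ⟨fun
      | .a => ((0, 0), (r + 2, 0))
      | .b => ((2, 0), (r + 4, 0))
      | .q => ((j.val + 1, 0), (j.val + 2, 0))
      | .x i => (((if i ≤ j then i.val else i.val + 2), 0),
          ((if i ≤ j then i.val else i.val + 2) + 1, 0)), ?_⟩
    obtain ⟨j, hj⟩ := j
    rintro (_ | _ | _ | ⟨i, hi⟩) (_ | _ | _ | ⟨i', hi'⟩) hu hv huv <;>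
      simp [F10, Meets] at * <;> (try split_ifs) <;> (try simp only [false_or]) <;> omega

/-! ### The families with many simplicial vertices -/

instance (r : ℕ) : Finite (V11 r) :=
  Finite.of_surjective (fun o : Option (Option (Fin (2 * r + 1) ⊕ Fin (2 * r + 1))) => match o with
    | none => V11.a
    | some none => V11.b
    | some (some (.inl i)) => V11.s i
    | some (some (.inr i)) => V11.v i) fun v => match v with
    | .a => ⟨none, rfl⟩
    | .b => ⟨some none, rfl⟩
    | .s i => ⟨some (some (.inl i)), rfl⟩
    | .v i => ⟨some (some (.inr i)), rfl⟩

instance (r : ℕ) : Finite (V13 r) :=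
  Finite.of_surjective (fun o : Option (Option (Fin (2 * r + 1) ⊕ Fin (2 * r + 2))) => match o with
    | none => V13.q
    | some none => V13.x
    | some (some (.inl i)) => V13.s i
    | some (some (.inr i)) => V13.v i) fun v => match v with
    | .q => ⟨none, rfl⟩
    | .x => ⟨some none, rfl⟩
    | .s i => ⟨some (some (.inl i)), rfl⟩
    | .v i => ⟨some (some (.inr i)), rfl⟩

instance (r : ℕ) : Finite (V15 r) :=
  Finite.of_surjective
    (fun o : Option (Option (Option (Fin (2 * r + 1) ⊕ Fin (2 * r + 2)))) => match o with
    | none => V15.q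
    | some none => V15.x
    | some (some none) => V15.y
    | some (some (some (.inl i))) => V15.s i
    | some (some (some (.inr i))) => V15.v i) fun v => match v with
    | .q => ⟨none, rfl⟩
    | .x => ⟨some none, rfl⟩
    | .y => ⟨some (some none), rfl⟩
    | .s i => ⟨some (some (some (.inl i))), rfl⟩
    | .v i => ⟨some (some (some (.inr i))), rfl⟩

instance (k : ℕ) : Finite (V16 k) :=
  Finite.of_surjective (fun o : Option (Option (Fin (2 * k) ⊕ Fin (2 * k + 1))) => match o with
    | none => V16.a
    | some none => V16.b
    | some (some (.inl i)) => V16.s i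
    | some (some (.inr i)) => V16.v i) fun v => match v with
    | .a => ⟨none, rfl⟩
    | .b => ⟨some none, rfl⟩
    | .s i => ⟨some (some (.inl i)), rfl⟩
    | .v i => ⟨some (some (.inr i)), rfl⟩

/-- A property that alternates along a range of indices has the parity of the index. -/
lemma iff_of_alternating {N : ℕ} (P : Fin N → Prop) (lo hi : ℕ)
    (h : ∀ i j : Fin N, i.val + 1 = j.val → lo ≤ i.val → j.val ≤ hi → (P j ↔ ¬ P i))
    (d : ℕ) (i j : Fin N) (hij : i.val + d = j.val) (hi' : lo ≤ i.val) (hj : j.val ≤ hi) :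
    P j ↔ (d % 2 = 0 ↔ P i) := by
  induction d generalizing j with
  | zero =>
    obtain rfl : i = j := Fin.ext (by simpa using hij)
    simp
  | succ d ih =>
    have hlt : j.val - 1 < N := by omega
    rw [h ⟨j.val - 1, hlt⟩ j (by simp only; omega) (by simp only; omega) hj,
      ih ⟨j.val - 1, hlt⟩ (by simp only; omega) (by simp only; omega)]
    rcases Nat.mod_two_eq_zero_or_one d with h | h
    · have h' : (d + 1) % 2 ≠ 0 := by omega
      simp [h, h']
    · have h' : (d + 1) % 2 = 0 := by omega
      simp [h, h']

/-- With `c` the color of a fixed vertex, this turns "at most two colors" into alternation. -/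
lemma eq_iff_not_of_two {α : Type*} {a b c : α} (hne : a ≠ b) (h : a = b ∨ b = c ∨ a = c) :
    b = c ↔ ¬ a = c := by
  constructor
  · rintro rfl
    exact hne
  · tauto

/-! ### Odd suns: `F11` and `F12` -/

lemma F11_adj_v_s {r : ℕ} (i j : Fin (2 * r + 1)) : (F11 r).Adj (.v i) (.s j) ↔
    j.val = i.val ∨ j.val = i.val + 1 ∨ (j.val = 0 ∧ i.val = 2 * r) := by
  simp only [F11, fromRel_adj, ne_eq, reduceCtorEq, not_false_eq_true, Fin.ext_iff,
    Fin.val_add_one, Fin.val_last, true_and, or_false]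
  split_ifs <;> omega

lemma F12_adj_v_s {r : ℕ} (i j : Fin (2 * r + 1)) : (F12 r).Adj (.v i) (.s j) ↔
    j.val = i.val ∨ j.val = i.val + 1 ∨ (j.val = 0 ∧ i.val = 2 * r) := by
  simp only [F12, fromRel_adj, ne_eq, reduceCtorEq, not_false_eq_true, Fin.ext_iff,
    Fin.val_add_one, Fin.val_last, true_and, or_false]
  split_ifs <;> omega

/-- The edges common to `F11 r` and `F12 r`; those between `b` and the `v i` are left open. -/
structure IsOddSun {r : ℕ} (G : SimpleGraph (V11 r)) : Prop where
  ab : ¬ G.Adj .a .b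
  a_s : ∀ j, G.Adj .a (.s j)
  av : ∀ i, ¬ G.Adj .a (.v i)
  bs : ∀ j, G.Adj .b (.s j)
  ss : ∀ i j, i ≠ j → G.Adj (.s i) (.s j)
  vs : ∀ i j : Fin (2 * r + 1), G.Adj (.v i) (.s j) ↔
    j.val = i.val ∨ j.val = i.val + 1 ∨ (j.val = 0 ∧ i.val = 2 * r)
  vv : ∀ i j, ¬ G.Adj (.v i) (.v j)

lemma isOddSun_F11 (r : ℕ) : IsOddSun (F11 r) where
  ab := by simp [F11]
  a_s j := by simp [F11]
  av i := by simp [F11]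
  bs j := by simp [F11]
  ss i j hij := by simp [F11, hij]
  vs := F11_adj_v_s
  vv i j := by simp [F11]

lemma isOddSun_F12 (r : ℕ) : IsOddSun (F12 r) where
  ab := by simp [F12]
  a_s j := by simp [F12]
  av i := by simp [F12]
  bs j := by simp [F12]
  ss i j hij := by simp [F12, hij]
  vs := F12_adj_v_s
  vv i j := by simp [F12]

/-- The maximal clique consists of `a` and the `s j`. Cyclically consecutive `v i` and `v j` are
incomparable, and both they and `b` are adjacent to `s j`; so exactly one of the two has the color
of `b`. This is impossible around an odd cycle. Edges between `b` and the `v i` play no role. -/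
lemma IsOddSun.not_isPathGraph {r : ℕ} (hr : 1 ≤ r) {G : SimpleGraph (V11 r)} (hG : IsOddSun G) :
    ¬ IsPathGraph G := fun h => by
  obtain ⟨B⟩ := h.nonempty_branching (fun | .a => True | .s _ => True | _ => False)
    (by
      rintro (_ | _ | i | i) (_ | _ | j | j) hu hv huv
      all_goals first | exact (huv rfl).elim | exact hu.elim | exact hv.elim | skip
      · exact hG.a_s j
      · exact (hG.a_s i).symm
      · exact hG.ss i j fun h => huv (h ▸ rfl))
    (by
      rintro (_ | _ | i | i) hv
      · exact (hv trivial).elim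
      · exact ⟨.a, trivial, fun h => hG.ab h.symm⟩
      · exact (hv trivial).elim
      · exact ⟨.a, trivial, fun h => hG.av i h.symm⟩)
  have hstep : ∀ i j : Fin (2 * r + 1), (i.val + 1 = j.val ∨ (j.val = 0 ∧ i.val = 2 * r)) →
      (B.color (.v j) = B.color .b ↔ ¬ B.color (.v i) = B.color .b) := by
    intro i j hij
    have hi : G.Adj (.s j) (.v i) := ((hG.vs i j).2 (by omega)).symm
    have hj : G.Adj (.s j) (.v j) := ((hG.vs j j).2 (by omega)).symm
    obtain ⟨k, hk⟩ : ∃ k : Fin (2 * r + 1),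
        k.val = j.val + 1 ∨ (k.val = 0 ∧ j.val = 2 * r) := by
      by_cases h : j.val = 2 * r
      · exact ⟨0, .inr ⟨rfl, h⟩⟩
      · exact ⟨⟨j.val + 1, by omega⟩, .inl rfl⟩
    refine eq_iff_not_of_two (B.color_ne id id (.s j) (.s i) (.s k) trivial trivial trivial hi hj
      ((hG.vs i i).2 (by omega)).symm (fun h => ?_) ((hG.vs j k).2 (by omega)).symm fun h => ?_)
      (B.two_colors (z := .s j) trivial id id id hi hj (hG.bs j).symm)
    · have := (hG.vs j i).1 h.symm
      omega
    · have := (hG.vs i k).1 h.symm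
      omega
  have h1 := iff_of_alternating (fun i => B.color (.v i) = B.color .b) 0 (2 * r)
    (fun i j hij _ _ => hstep i j (.inl hij)) (2 * r) 0 (Fin.last (2 * r)) (by simp) (by simp)
    (by simp)
  have h2 := hstep (Fin.last (2 * r)) 0 (.inr ⟨rfl, rfl⟩)
  simp only [Nat.mul_mod_right, true_iff] at h1
  tauto

/-! ### Caterpillar models checked pair by pair -/

lemma Meets.symm {p q : (ℕ × ℕ) × (ℕ × ℕ)} (h : Meets p q) : Meets q p := by
  rw [meets_iff] at *
  obtain ⟨x, h1, h2⟩ := h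
  exact ⟨x, h2, h1⟩

lemma meets_comm {p q : (ℕ × ℕ) × (ℕ × ℕ)} : Meets p q ↔ Meets q p := ⟨Meets.symm, Meets.symm⟩

/-- The vertices are represented correctly relative to each other. -/
def Fits {V : Type*} (G : SimpleGraph V) (f : V → (ℕ × ℕ) × (ℕ × ℕ)) (u v : V) : Prop :=
  G.Adj u v ↔ Meets (f u) (f v)

lemma Fits.symm {V : Type*} {G : SimpleGraph V} {f : V → (ℕ × ℕ) × (ℕ × ℕ)} {u v : V}
    (h : Fits G f u v) : Fits G f v u := by
  rw [Fits, adj_comm, meets_comm]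
  exact h

lemma meets_leaf {l e : ℕ} (he : e ≠ 0) {q : (ℕ × ℕ) × (ℕ × ℕ)} :
    Meets ((l, e), (l, e)) q ↔ (l, e) = q.1 ∨ (l, e) = q.2 := by
  simp [Meets, he]
  tauto

/-- The path `q` contains the spine vertices `0` and `1`, and `p` has a spine vertex at `0` or `1`.
In the models with two spine vertices this makes the clique pairwise intersecting. -/
lemma meets_of_span {p q : (ℕ × ℕ) × (ℕ × ℕ)} (hq : q.1.1 + q.2.1 = 1)
    (hp : p.1 ≠ p.2 ∨ p.1.2 = 0) (hp' : p.1.1 ≤ 1 ∨ p.2.1 ≤ 1) : Meets p q := by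
  refine .inr (.inr (.inr (.inr ⟨hp, .inl fun h => ?_, by omega, by omega⟩)))
  have := congrArg Prod.fst h
  omega

lemma meets_of_center {p q : (ℕ × ℕ) × (ℕ × ℕ)} (hp : p.1 ≠ p.2 ∨ p.1.2 = 0)
    (hq : q.1 ≠ q.2 ∨ q.1.2 = 0) (hp1 : p.1.1 = 0) (hp2 : p.2.1 = 0) (hq1 : q.1.1 = 0)
    (hq2 : q.2.1 = 0) : Meets p q :=
  .inr (.inr (.inr (.inr ⟨hp, hq, by omega, by omega⟩)))

lemma span_spine {p : (ℕ × ℕ) × (ℕ × ℕ)} (hp : p.1.1 + p.2.1 = 1) : p.1 ≠ p.2 ∨ p.1.2 = 0 :=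
  .inl fun h => by
    have := congrArg Prod.fst h
    omega

/-- The steps from `j` to `i` in the cyclic order of `0, ..., n - 1`. -/
def cyclicSteps (n j i : ℕ) : ℕ := if j ≤ i then i - j else i + n - j

lemma cyclicSteps_spec {n j i : ℕ} (hj : j < n) (hi : i < n) :
    cyclicSteps n j i < n ∧ (j ≤ i ∧ cyclicSteps n j i = i - j ∨
      i < j ∧ cyclicSteps n j i = i + n - j) := by
  unfold cyclicSteps
  split_ifs <;> omega

/-- The path of the clique vertex `k` steps after a deleted one, the simplicial vertices being
leaves at `(0, 0)` and `(1, 0)` alternately. -/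
def cyclicCliqueEnds (r k : ℕ) : (ℕ × ℕ) × (ℕ × ℕ) :=
  if k = 0 then ((0, 2 * r + 1), (1, 0)) else ((1 - k % 2, k), (k % 2, k + 1))

lemma cyclicCliqueEnds_span (r k : ℕ) :
    (cyclicCliqueEnds r k).1.1 + (cyclicCliqueEnds r k).2.1 = 1 := by
  unfold cyclicCliqueEnds
  split_ifs
  · rfl
  · simp only
    omega

/-- The exception `k = l = 0` is the price of an odd cycle: the leaves at steps `0` and `2 * r` are
both at `(0, 0)`, so the clique path at step `0` gives up its own leaf in order to reach `(1, 0)`.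
-/
lemma meets_leaf_cyclicCliqueEnds {r k l : ℕ} (hk : k < 2 * r + 1) (hl : l < 2 * r + 1)
    (hkl : k ≠ 0 ∨ l ≠ 0) : Meets ((k % 2, k + 1), (k % 2, k + 1)) (cyclicCliqueEnds r l) ↔
      l = k ∨ l = k + 1 ∨ (l = 0 ∧ k = 2 * r) := by
  rw [meets_leaf (by omega), cyclicCliqueEnds]
  split_ifs with h
  · simp only [Prod.mk.injEq]
    omega
  · simp only [Prod.mk.injEq]
    omega

/-- The relation `R` selects the pairs to be represented correctly, so that one model with a single
wrong pair serves for the deletion of either of its vertices. -/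
lemma V11.forall_fits {r : ℕ} {G : SimpleGraph (V11 r)} {f : V11 r → (ℕ × ℕ) × (ℕ × ℕ)}
    {R : V11 r → V11 r → Prop} (hR : ∀ u v, R u v → R v u)
    (hab : R .a .b → Fits G f .a .b) (has : ∀ j, R .a (.s j) → Fits G f .a (.s j))
    (hav : ∀ i, R .a (.v i) → Fits G f .a (.v i)) (hbs : ∀ j, R .b (.s j) → Fits G f .b (.s j))
    (hbv : ∀ i, R .b (.v i) → Fits G f .b (.v i))
    (hss : ∀ i j, i ≠ j → R (.s i) (.s j) → Fits G f (.s i) (.s j))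
    (hvs : ∀ i j, R (.v i) (.s j) → Fits G f (.v i) (.s j))
    (hvv : ∀ i j, i ≠ j → R (.v i) (.v j) → Fits G f (.v i) (.v j)) :
    ∀ u v, u ≠ v → R u v → Fits G f u v := by
  rintro (_ | _ | i | i) (_ | _ | j | j) huv h
  all_goals first | exact (huv rfl).elim | skip
  · exact hab h
  · exact has j h
  · exact hav j h
  · exact (hab (hR _ _ h)).symm
  · exact hbs j h
  · exact hbv j h
  · exact (has i (hR _ _ h)).symm
  · exact (hbs i (hR _ _ h)).symm
  · exact hss i j (fun h => huv (h ▸ rfl)) h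
  · exact (hvs j i (hR _ _ h)).symm
  · exact (hav i (hR _ _ h)).symm
  · exact (hbv i (hR _ _ h)).symm
  · exact hvs i j h
  · exact hvv i j (fun h => huv (h ▸ rfl)) h

/-- A representation of all pairs but `v j`, `s j`. -/
lemma IsOddSun.exists_model {r : ℕ} {G : SimpleGraph (V11 r)} (hG : IsOddSun G)
    (j : Fin (2 * r + 1)) (p e : ℕ) (hp : p ≤ 1)
    (hbv : ∀ i : Fin (2 * r + 1), G.Adj .b (.v i) ↔
      p = cyclicSteps (2 * r + 1) j i % 2 ∧ e = cyclicSteps (2 * r + 1) j i + 1) :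
    ∃ f, ∀ u v, u ≠ v → ((u ≠ .v j ∨ v ≠ .s j) ∧ (v ≠ .v j ∨ u ≠ .s j)) → Fits G f u v := by
  -- The vertices `a` and `b` take opposite spine vertices; `b` may extend to the leaf of a `v i`
  -- adjacent to it, and `e = 0` means no extension.
  obtain ⟨f, ha, hb, hs, hv⟩ : ∃ f : V11 r → (ℕ × ℕ) × (ℕ × ℕ),
      f .a = ((1 - p, 0), (1 - p, 0)) ∧ f .b = ((p, 0), (p, e)) ∧
      (∀ i, f (.s i) = cyclicCliqueEnds r (cyclicSteps (2 * r + 1) j i)) ∧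
      ∀ i, f (.v i) = ((cyclicSteps (2 * r + 1) j i % 2, cyclicSteps (2 * r + 1) j i + 1),
        (cyclicSteps (2 * r + 1) j i % 2, cyclicSteps (2 * r + 1) j i + 1)) :=
    ⟨fun
      | .a => _
      | .b => _
      | .s i => _
      | .v i => _, rfl, rfl, fun _ => rfl, fun _ => rfl⟩
  have hbspine : (f .b).1 ≠ (f .b).2 ∨ (f .b).1.2 = 0 := by rw [hb]; exact .inr rfl
  refine ⟨f, V11.forall_fits (fun u v h => h.symm) (fun _ => ?_) (fun i _ => ?_) (fun i _ => ?_)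
    (fun i _ => ?_) (fun i _ => ?_) (fun i i' hii' _ => ?_) (fun i i' h => ?_)
    (fun i i' hii' _ => ?_)⟩ <;> rw [Fits]
  · refine iff_of_false hG.ab ?_
    rw [ha, hb]
    simp only [Meets, Prod.mk.injEq, ne_eq]
    omega
  · refine iff_of_true (hG.a_s i) (meets_of_span ?_ ?_ ?_)
    · rw [hs]
      exact cyclicCliqueEnds_span r _
    · rw [ha]
      exact .inr rfl
    · rw [ha]
      simp only
      omega
  · refine iff_of_false (hG.av i) ?_
    rw [meets_comm, hv, meets_leaf (by omega), ha]
    simp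
  · refine iff_of_true (hG.bs i) (meets_of_span ?_ hbspine ?_)
    · rw [hs]
      exact cyclicCliqueEnds_span r _
    · rw [hb]
      exact .inl hp
  · rw [hbv, meets_comm, hv, meets_leaf (by omega), hb]
    simp only [Prod.mk.injEq]
    omega
  · refine iff_of_true (hG.ss i i' hii') (meets_of_span ?_ (span_spine ?_) ?_)
    · rw [hs]
      exact cyclicCliqueEnds_span r _
    · rw [hs]
      exact cyclicCliqueEnds_span r _
    · rw [hs]
      have := cyclicCliqueEnds_span r (cyclicSteps (2 * r + 1) j i)
      omega
  · have hi := cyclicSteps_spec j.isLt i.isLt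
    have hi' := cyclicSteps_spec j.isLt i'.isLt
    rw [hG.vs, hv, hs, meets_leaf_cyclicCliqueEnds hi.1 hi'.1]
    · omega
    -- Both at step `0` means the pair `v j`, `s j`, which `R` excludes.
    · by_contra! h0
      have h1 : i = j := Fin.ext (by omega)
      have h2 : i' = j := Fin.ext (by omega)
      simp [h1, h2] at h
  · have hi := cyclicSteps_spec j.isLt i.isLt
    have hi' := cyclicSteps_spec j.isLt i'.isLt
    have hne : i.val ≠ i'.val := fun h => hii' (Fin.ext h)
    refine iff_of_false (hG.vv i i') ?_
    rw [hv, meets_leaf (by omega), hv]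
    simp only [Prod.mk.injEq]
    omega

/-- A representation of all pairs but `a`, `b`. -/
lemma IsOddSun.exists_star_model {r : ℕ} (hr : 1 ≤ r) {G : SimpleGraph (V11 r)} (hG : IsOddSun G)
    (e : ℕ) (hbv : ∀ i : Fin (2 * r + 1), G.Adj .b (.v i) ↔ e = i.val + 1) :
    ∃ f, ∀ u v, u ≠ v → ((u ≠ .a ∨ v ≠ .b) ∧ (v ≠ .a ∨ u ≠ .b)) → Fits G f u v := by
  -- In a star the cyclic order meets no parity condition, but `a` and `b` both contain the centre.
  obtain ⟨f, ha, hb, hs, hv⟩ : ∃ f : V11 r → (ℕ × ℕ) × (ℕ × ℕ),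
      f .a = ((0, 0), (0, 0)) ∧ f .b = ((0, 0), (0, e)) ∧
      (∀ i, f (.s i) = ((0, if i.val = 0 then 2 * r + 1 else i.val), (0, i.val + 1))) ∧
      ∀ i, f (.v i) = ((0, i.val + 1), (0, i.val + 1)) :=
    ⟨fun
      | .a => _
      | .b => _
      | .s i => _
      | .v i => _, rfl, rfl, fun _ => rfl, fun _ => rfl⟩
  have hspine : ∀ i, (f (.s i)).1 ≠ (f (.s i)).2 ∨ (f (.s i)).1.2 = 0 := by
    intro i
    rw [hs]
    refine .inl fun h => ?_
    simp only [Prod.mk.injEq, true_and] at h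
    split_ifs at h <;> omega
  refine ⟨f, V11.forall_fits (fun u v h => h.symm) (fun h => ?_) (fun i _ => ?_) (fun i _ => ?_)
    (fun i _ => ?_) (fun i _ => ?_) (fun i i' hii' _ => ?_) (fun i i' h => ?_)
    (fun i i' hii' _ => ?_)⟩ <;> rw [Fits]
  · simp at h
  · refine iff_of_true (hG.a_s i) (meets_of_center ?_ (hspine i) ?_ ?_ ?_ ?_) <;> simp [ha, hs]
  · refine iff_of_false (hG.av i) ?_
    rw [meets_comm, hv, meets_leaf (by omega), ha]
    simp
  · refine iff_of_true (hG.bs i) (meets_of_center ?_ (hspine i) ?_ ?_ ?_ ?_) <;> simp [hb, hs]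
  · rw [hbv, meets_comm, hv, meets_leaf (by omega), hb]
    simp only [Prod.mk.injEq, true_and]
    omega
  · refine iff_of_true (hG.ss i i' hii') (meets_of_center (hspine i) (hspine i') ?_ ?_ ?_ ?_) <;>
      simp [hs]
  · rw [hG.vs, hv, meets_leaf (by omega), hs]
    simp only [Prod.mk.injEq, true_and]
    split_ifs <;> omega
  · have hne : i.val ≠ i'.val := fun h => hii' (Fin.ext h)
    refine iff_of_false (hG.vv i i') ?_
    rw [hv, meets_leaf (by omega), hv]
    simp only [Prod.mk.injEq, true_and]
    omega

lemma IsOddSun.isMinimalNonPathGraph {r : ℕ} (hr : 1 ≤ r) {G : SimpleGraph (V11 r)}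
    (hG : IsOddSun G)
    (hbv : (∀ i, ¬ G.Adj .b (.v i)) ∨ ∀ i : Fin (2 * r + 1), G.Adj .b (.v i) ↔ i.val = 0) :
    IsMinimalNonPathGraph G := by
  refine isMinimalNonPathGraph_of_meets (hG.not_isPathGraph hr) fun d => ?_
  have main : ∀ j : Fin (2 * r + 1), ∃ f, ∀ u v, u ≠ v →
      ((u ≠ .v j ∨ v ≠ .s j) ∧ (v ≠ .v j ∨ u ≠ .s j)) → Fits G f u v := by
    intro j
    rcases hbv with hbv | hbv
    · refine hG.exists_model j 1 0 le_rfl fun i => iff_of_false (hbv i) ?_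
      omega
    -- In this case `b` ends at the leaf of `v 0`.
    · refine hG.exists_model j (cyclicSteps (2 * r + 1) j 0 % 2) (cyclicSteps (2 * r + 1) j 0 + 1)
        (by omega) fun i => ?_
      rw [hbv]
      have h0 := cyclicSteps_spec (i := 0) j.isLt (by omega)
      have hi := cyclicSteps_spec j.isLt i.isLt
      constructor
      · intro h
        rw [h]
        exact ⟨rfl, rfl⟩
      · omega
  have star : ∃ f, ∀ u v, u ≠ v → ((u ≠ .a ∨ v ≠ .b) ∧ (v ≠ .a ∨ u ≠ .b)) → Fits G f u v := by
    rcases hbv with hbv | hbv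
    · exact hG.exists_star_model hr 0 fun i => iff_of_false (hbv i) (by omega)
    · exact hG.exists_star_model hr 1 fun i => (hbv i).trans (by omega)
  rcases d with _ | _ | j | j
  · obtain ⟨f, hf⟩ := star
    exact ⟨f, fun u v hu hv huv => hf u v huv ⟨.inl hu, .inl hv⟩⟩
  · obtain ⟨f, hf⟩ := star
    exact ⟨f, fun u v hu hv huv => hf u v huv ⟨.inr hv, .inr hu⟩⟩
  · obtain ⟨f, hf⟩ := main j
    exact ⟨f, fun u v hu hv huv => hf u v huv ⟨.inr hv, .inr hu⟩⟩
  · obtain ⟨f, hf⟩ := main j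
    exact ⟨f, fun u v hu hv huv => hf u v huv ⟨.inl hu, .inl hv⟩⟩

theorem isMinimalNonPathGraph_F11 {r : ℕ} (hr : 1 ≤ r) : IsMinimalNonPathGraph (F11 r) :=
  (isOddSun_F11 r).isMinimalNonPathGraph hr (.inl fun i => by simp [F11])

theorem isMinimalNonPathGraph_F12 {r : ℕ} (hr : 1 ≤ r) : IsMinimalNonPathGraph (F12 r) :=
  (isOddSun_F12 r).isMinimalNonPathGraph hr (.inr fun i => by simp [F12])

/-! ### Alternation of colors along chains: `F13` to `F16` are not path graphs -/

/-- If consecutive vertices `v i` have a common neighbour in the clique, which is also adjacent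
to `q`, and incomparable neighbourhoods there, then they are alternately in the branch of `q` and
outside it. -/
lemma Branching.color_eq_iff_of_chain {V : Type*} {G : SimpleGraph V} {Q : V → Prop}
    (B : Branching G Q) {N : ℕ} (v : Fin N → V) (q : V) (hq : ¬ Q q) (hv : ∀ i, ¬ Q (v i))
    (lo hi : ℕ)
    (h : ∀ i j : Fin N, i.val + 1 = j.val → lo ≤ i.val → j.val ≤ hi → ∃ z z₁ z₂, Q z ∧ Q z₁ ∧
      Q z₂ ∧ G.Adj z q ∧ G.Adj z (v i) ∧ G.Adj z (v j) ∧ G.Adj z₁ (v i) ∧ ¬ G.Adj z₁ (v j) ∧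
      G.Adj z₂ (v j) ∧ ¬ G.Adj z₂ (v i))
    (d : ℕ) (i j : Fin N) (hij : i.val + d = j.val) (hi' : lo ≤ i.val) (hj : j.val ≤ hi) :
    B.color (v j) = B.color q ↔ (d % 2 = 0 ↔ B.color (v i) = B.color q) := by
  refine iff_of_alternating (fun i => B.color (v i) = B.color q) lo hi (fun i j hij hi' hj => ?_)
    d i j hij hi' hj
  obtain ⟨z, z₁, z₂, hz, h₁, h₂, hzq, hzi, hzj, h₁i, h₁j, h₂j, h₂i⟩ := h i j hij hi' hj
  exact eq_iff_not_of_two (B.color_ne (hv i) (hv j) z z₁ z₂ hz h₁ h₂ hzi hzj h₁i h₁j h₂j h₂i)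
    (B.two_colors hz (hv i) (hv j) hq hzi hzj hzq)

/-- Neither `v 0` nor the last `v i` has the color of `q`. At `s 1` the vertices `v 0`, `v 1`, `q`
use two colors and `v 0` differs from both others, so `v 1` has the color of `q`. Alternating over
`2 * r` steps, the last vertex has it as well, a contradiction. -/
lemma not_isPathGraph_F13 {r : ℕ} (hr : 1 ≤ r) : ¬ IsPathGraph (F13 r) := fun h => by
  obtain ⟨B⟩ := h.nonempty_branching (fun | .x => True | .s _ => True | _ => False)
    (by
      rintro (_ | _ | i | i) (_ | _ | j | j) hu hv huv <;> simp_all [F13])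
    (by
      rintro (_ | _ | i | ⟨i, hi⟩) hv
      · exact ⟨.x, trivial, by simp [F13]⟩
      · exact (hv trivial).elim
      · exact (hv trivial).elim
      · by_cases h0 : i = 0
        · subst h0
          exact ⟨.s 0, trivial, by simp [F13]⟩
        · by_cases h1 : i = 1
          · exact ⟨.x, trivial, by simp [F13]; omega⟩
          · exact ⟨.s 0, trivial, by simp [F13]; omega⟩)
  have h0q : B.color (.v 0) ≠ B.color .q :=
    B.color_ne id id (.s ⟨1, by omega⟩) .x (.s 0) trivial trivial trivial
      (by simp [F13]) (by simp [F13]) (by simp [F13]) (by simp [F13]) (by simp [F13])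
      (by simp [F13])
  have hlq : B.color (.v (Fin.last (2 * r + 1))) ≠ B.color .q :=
    B.color_ne id id (.s (Fin.last (2 * r))) .x (.s 0) trivial trivial trivial
      (by simp [F13]) (by simp [F13]) (by simp [F13]) (by simp [F13]) (by simp [F13])
      (by simp [F13]; omega)
  have h01 : B.color (.v 0) ≠ B.color (.v ⟨1, by omega⟩) :=
    B.color_ne id id (.s ⟨1, by omega⟩) .x (.s 0) trivial trivial trivial
      (by simp [F13]) (by simp [F13]) (by simp [F13]) (by simp [F13]; omega) (by simp [F13])
      (by simp [F13])
  have h := B.color_eq_iff_of_chain V13.v .q id (fun _ => id) 1 (2 * r + 1) (by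
    rintro ⟨i, hi⟩ ⟨j, hj⟩ hij h1 hj'
    simp only at hij h1 hj'
    refine ⟨.s ⟨i, by omega⟩, .s ⟨i - 1, by omega⟩, ?_⟩
    by_cases hjl : j = 2 * r + 1
    · refine ⟨.x, trivial, trivial, trivial, ?_⟩
      simp [F13]
      omega
    · refine ⟨.s ⟨j, by omega⟩, trivial, trivial, trivial, ?_⟩
      simp [F13]
      omega) (2 * r) ⟨1, by omega⟩ (Fin.last (2 * r + 1)) (by simp; omega) le_rfl (by simp)
  have h2 := B.two_colors (z := .s ⟨1, by omega⟩) (u := .v 0) (v := .v ⟨1, by omega⟩) (w := .q)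
    trivial id id id (by simp [F13]) (by simp [F13]) (by simp [F13])
  simp only [Nat.mul_mod_right, true_iff] at h
  tauto

/-- Both ends of the chain avoid the color of `q`, but they are an odd number of alternations apart.
Where no clique vertex `s j` tells an end from its neighbour in the chain, `x` does. -/
lemma not_isPathGraph_F14 {r : ℕ} (hr : 1 ≤ r) : ¬ IsPathGraph (F14 r) := fun h => by
  obtain ⟨B⟩ := h.nonempty_branching (fun | .x => True | .s _ => True | _ => False)
    (by
      rintro (_ | _ | i | i) (_ | _ | j | j) hu hv huv <;> simp_all [F14])
    (by
      rintro (_ | _ | i | i) hv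
      · exact ⟨.x, trivial, by simp [F14]⟩
      · exact (hv trivial).elim
      · exact (hv trivial).elim
      · by_cases hi : i.val = 0 ∨ i.val = 1
        · exact ⟨.s (Fin.last (2 * r)), trivial, by simp [F14]; omega⟩
        · exact ⟨.s 0, trivial, by simp [F14]; omega⟩)
  have h0q : B.color (.v 0) ≠ B.color .q :=
    B.color_ne id id (.s 0) .x (.s ⟨1, by omega⟩) trivial trivial trivial
      (by simp [F14]) (by simp [F14]) (by simp [F14]) (by simp [F14]) (by simp [F14])
      (by simp [F14])
  have hlq : B.color (.v (Fin.last (2 * r + 1))) ≠ B.color .q :=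
    B.color_ne id id (.s (Fin.last (2 * r))) .x (.s 0) trivial trivial trivial
      (by simp [F14]) (by simp [F14]) (by simp [F14]) (by simp [F14]) (by simp [F14])
      (by simp [F14]; omega)
  have h := B.color_eq_iff_of_chain V13.v .q id (fun _ => id) 0 (2 * r + 1) (by
    rintro ⟨i, hi⟩ ⟨j, hj⟩ hij h1 hj'
    simp only at hij h1 hj'
    refine ⟨.s ⟨i, by omega⟩, if i = 0 then .x else .s ⟨i - 1, by omega⟩,
      if hj : j = 2 * r + 1 then .x else .s ⟨j, by omega⟩, ?_⟩
    split_ifs <;> refine ⟨trivial, trivial, trivial, ?_⟩ <;> simp [F14] <;> omega)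
    (2 * r + 1) 0 (Fin.last (2 * r + 1)) (by simp) le_rfl (by simp)
  have hodd : (2 * r + 1) % 2 ≠ 0 := by omega
  tauto

/-- The parity argument of `F14`, with `x` and `y` as the private clique neighbours of the two ends.
-/
lemma not_isPathGraph_F15 {r : ℕ} (hr : 1 ≤ r) : ¬ IsPathGraph (F15 r) := fun h => by
  obtain ⟨B⟩ := h.nonempty_branching (fun | .x => True | .y => True | .s _ => True | _ => False)
    (by
      rintro (_ | _ | _ | i | i) (_ | _ | _ | j | j) hu hv huv <;> simp_all [F15])
    (by
      rintro (_ | _ | _ | i | i) hv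
      · exact ⟨.x, trivial, by simp [F15]⟩
      · exact (hv trivial).elim
      · exact (hv trivial).elim
      · exact (hv trivial).elim
      · by_cases hi : i.val = 0 ∨ i.val = 1
        · exact ⟨.s (Fin.last (2 * r)), trivial, by simp [F15]; omega⟩
        · exact ⟨.s 0, trivial, by simp [F15]; omega⟩)
  have h0q : B.color (.v 0) ≠ B.color .q :=
    B.color_ne id id (.s 0) .x (.s ⟨1, by omega⟩) trivial trivial trivial
      (by simp [F15]) (by simp [F15]) (by simp [F15]) (by simp [F15]) (by simp [F15])
      (by simp [F15])
  have hlq : B.color (.v (Fin.last (2 * r + 1))) ≠ B.color .q :=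
    B.color_ne id id (.s (Fin.last (2 * r))) .y (.s 0) trivial trivial trivial
      (by simp [F15]) (by simp [F15]) (by simp [F15]) (by simp [F15]) (by simp [F15])
      (by simp [F15]; omega)
  have h := B.color_eq_iff_of_chain V15.v .q id (fun _ => id) 0 (2 * r + 1) (by
    rintro ⟨i, hi⟩ ⟨j, hj⟩ hij h1 hj'
    simp only at hij h1 hj'
    refine ⟨.s ⟨i, by omega⟩, if i = 0 then .x else .s ⟨i - 1, by omega⟩,
      if hj : j = 2 * r + 1 then .y else .s ⟨j, by omega⟩, ?_⟩
    split_ifs <;> refine ⟨trivial, trivial, trivial, ?_⟩ <;> simp [F15] <;> omega)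
    (2 * r + 1) 0 (Fin.last (2 * r + 1)) (by simp) le_rfl (by simp)
  have hodd : (2 * r + 1) % 2 ≠ 0 := by omega
  tauto

/-- Alternation from `v 0` gives `v (2k-1)` the color of `b`, shared by `v (2k)`, which is adjacent
to `b`. In this branch `v (2k-1)` is between `b` and `v (2k)` without being adjacent to either. -/
lemma not_isPathGraph_F16 {k : ℕ} (hk : 2 ≤ k) : ¬ IsPathGraph (F16 k) := fun h => by
  obtain ⟨B⟩ := h.nonempty_branching (fun | .a => True | .s _ => True | _ => False)
    (by
      rintro (_ | _ | i | i) (_ | _ | j | j) hu hv huv <;> simp_all [F16])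
    (by
      rintro (_ | _ | i | i) hv
      · exact (hv trivial).elim
      · exact ⟨.a, trivial, by simp [F16]⟩
      · exact (hv trivial).elim
      · by_cases hi : i.val = 0 ∨ i.val = 1
        · exact ⟨.s ⟨2, by omega⟩, trivial, by simp [F16]; omega⟩
        · exact ⟨.s ⟨0, by omega⟩, trivial, by simp [F16]; omega⟩)
  have h0b : B.color (.v 0) ≠ B.color .b :=
    B.color_ne id id (.s ⟨0, by omega⟩) .a (.s ⟨1, by omega⟩) trivial trivial trivial
      (by simp [F16]) (by simp [F16]) (by simp [F16]) (by simp [F16]) (by simp [F16])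
      (by simp [F16])
  -- The chain stops before `v (2k)`, whose only neighbour in the clique is `s (2k-1)`, so that it
  -- is comparable to `v (2k-1)`.
  have h := B.color_eq_iff_of_chain V16.v .b id (fun _ => id) 0 (2 * k - 1) (by
    rintro ⟨i, hi⟩ ⟨j, hj⟩ hij h1 hj'
    simp only at hij h1 hj'
    refine ⟨.s ⟨i, by omega⟩, if i = 0 then .a else .s ⟨i - 1, by omega⟩,
      .s ⟨j, by omega⟩, ?_⟩
    split_ifs <;> refine ⟨trivial, trivial, trivial, ?_⟩ <;> simp [F16] <;> omega)
    (2 * k - 1) 0 ⟨2 * k - 1, by omega⟩ (by simp) le_rfl (by simp)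
  have hodd : (2 * k - 1) % 2 ≠ 0 := by omega
  have hpb : B.color (.v ⟨2 * k - 1, by omega⟩) = B.color .b := by tauto
  have hbl : B.color .b = B.color (.v (Fin.last (2 * k))) :=
    B.color_eq_of_adj id id (by simp [F16])
  have hle : B.le (.v ⟨2 * k - 1, by omega⟩) (.v (Fin.last (2 * k))) :=
    B.le_of_adj id id (.s ⟨2 * k - 1, by omega⟩) (.s ⟨2 * k - 2, by omega⟩) trivial trivial
      (by simp [F16]) (by simp [F16]; omega) (by simp [F16]; omega) (by simp [F16]; omega)
      (hpb.trans hbl)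
  have hle' : B.le .b (.v ⟨2 * k - 1, by omega⟩) :=
    B.le_of_adj id id (.s ⟨2 * k - 1, by omega⟩) (.s ⟨0, by omega⟩) trivial trivial
      (by simp [F16]) (by simp [F16]) (by simp [F16]) (by simp [F16]; omega) hpb.symm
  have hb : (F16 k).Adj .b (.v (Fin.last (2 * k))) := by simp [F16]
  refine B.not_le_le hb.toWalk (fun w hw => ?_) hle' hle
  simp only [Walk.support_cons, Walk.support_nil, List.mem_cons, List.not_mem_nil, or_false] at hw
  rcases hw with rfl | rfl
  · simp [F16]
    omega
  · have hne : Fin.last (2 * k) ≠ ⟨2 * k - 1, by omega⟩ := fun h => by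
      have := congrArg Fin.val h
      simp only [Fin.val_last] at this
      omega
    simp [F16, hne]

/-! ### Two-sided models of clique chains with one defect -/

/-- The side `0` or `1` of the `i`-th vertex of a chain, the sides alternating except between
`j - 1` and `j`. -/
def chainSide (j i : ℕ) : ℕ := if i < j then i % 2 else (i + 1) % 2

lemma chainSide_spec (j i : ℕ) : chainSide j i ≤ 1 ∧
    (i < j ∧ chainSide j i = i % 2 ∨ j ≤ i ∧ chainSide j i = (i + 1) % 2) := by
  unfold chainSide
  split_ifs <;> omega

/-- The path of the clique vertex adjacent to the `i`-th and the `i + 1`-st vertices of a chain,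
except that the former is left out when `i + 1 = j`. -/
def chainCliqueEnds (j i : ℕ) : (ℕ × ℕ) × (ℕ × ℕ) :=
  (if i + 1 = j then (1 - chainSide j (i + 1), 0) else (chainSide j i, i + 1),
    (chainSide j (i + 1), i + 2))

lemma chainCliqueEnds_span (j i : ℕ) :
    (chainCliqueEnds j i).1.1 + (chainCliqueEnds j i).2.1 = 1 := by
  have h := chainSide_spec j i
  have h' := chainSide_spec j (i + 1)
  unfold chainCliqueEnds
  split_ifs <;> simp only <;> omega

/-- A clique with vertices `s i`, and independent vertices `v i` adjacent to `s (i - 1)` and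
`s i`. -/
structure IsCliqueChain {V : Type*} (G : SimpleGraph V) {n : ℕ} (s : Fin n → V)
    (v : Fin (n + 1) → V) : Prop where
  ss : ∀ i j, i ≠ j → G.Adj (s i) (s j)
  vs : ∀ i l, G.Adj (v i) (s l) ↔ l.val = i.val ∨ l.val + 1 = i.val
  vv : ∀ i j, ¬ G.Adj (v i) (v j)

namespace IsCliqueChain

variable {V : Type*} {G : SimpleGraph V} {n : ℕ} {s : Fin n → V} {v : Fin (n + 1) → V}
  {f : V → (ℕ × ℕ) × (ℕ × ℕ)}

lemma fits_vv (h : IsCliqueChain G s v) (side : ℕ → ℕ)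
    (hv : ∀ i, f (v i) = ((side i.val, i.val + 1), (side i.val, i.val + 1)))
    {i i' : Fin (n + 1)} (hi : i ≠ i') : Fits G f (v i) (v i') := by
  have hne : i.val ≠ i'.val := fun h => hi (Fin.ext h)
  refine iff_of_false (h.vv i i') ?_
  rw [hv, meets_leaf (by omega), hv]
  simp only [Prod.mk.injEq]
  omega

lemma fits_ss (h : IsCliqueChain G s v) {j : ℕ} (hs : ∀ i, f (s i) = chainCliqueEnds j i.val) {i i' : Fin n}
    (hi : i ≠ i') : Fits G f (s i) (s i') := by
  have hspan := chainCliqueEnds_span j i.val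
  refine iff_of_true (h.ss i i' hi) (meets_of_span ?_ (span_spine ?_) ?_)
  · rw [hs]
    exact chainCliqueEnds_span _ _
  · rw [hs]
    exact hspan
  · rw [hs]
    omega

/-- The only possibly wrong pair is `v i`, `s i` with `i + 1 = j`: there the next leaf is on the
same side, and the path of `s i` gives up the leaf of `v i` to reach the opposite spine vertex. -/
lemma fits_vs (h : IsCliqueChain G s v) {j : ℕ} (hs : ∀ i, f (s i) = chainCliqueEnds j i.val)
    (hv : ∀ i, f (v i) = ((chainSide j i.val, i.val + 1), (chainSide j i.val, i.val + 1)))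
    {i : Fin (n + 1)} {l : Fin n} (hd : i.val = l.val → l.val + 1 ≠ j) :
    Fits G f (v i) (s l) := by
  rw [Fits, h.vs, hv, meets_leaf (by omega), hs, chainCliqueEnds]
  by_cases h0 : i.val = l.val
  · rw [if_neg (hd h0), h0]
    simp
  · by_cases h1 : i.val = l.val + 1
    · rw [h1]
      simp
    · split_ifs <;> simp only [Prod.mk.injEq] <;> omega

lemma fits_center_ss (h : IsCliqueChain G s v) (hs : ∀ i, f (s i) = ((0, i.val + 1), (0, i.val + 2))) {i i' : Fin n}
    (hi : i ≠ i') : Fits G f (s i) (s i') := by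
  refine iff_of_true (h.ss i i' hi) (meets_of_center ?_ ?_ ?_ ?_ ?_ ?_) <;> simp [hs]

lemma fits_center_vs (h : IsCliqueChain G s v) (hs : ∀ i, f (s i) = ((0, i.val + 1), (0, i.val + 2)))
    (hv : ∀ i, f (v i) = ((0, i.val + 1), (0, i.val + 1))) {i : Fin (n + 1)} {l : Fin n} :
    Fits G f (v i) (s l) := by
  rw [Fits, h.vs, hv, meets_leaf (by omega), hs]
  simp only [Prod.mk.injEq, true_and]
  omega

end IsCliqueChain

section Fits

variable {r : ℕ}

lemma fits_true_of_span {V : Type*} {G : SimpleGraph V} {f : V → (ℕ × ℕ) × (ℕ × ℕ)} {u v : V}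
    (huv : G.Adj u v) (hv : (f v).1.1 + (f v).2.1 = 1) (hu : (f u).1 ≠ (f u).2 ∨ (f u).1.2 = 0)
    (hu' : (f u).1.1 ≤ 1) : Fits G f u v :=
  iff_of_true huv (meets_of_span hv hu (.inl hu'))

lemma V13.forall_fits {G : SimpleGraph (V13 r)} {f : V13 r → (ℕ × ℕ) × (ℕ × ℕ)}
    {R : V13 r → V13 r → Prop} (hR : ∀ u v, R u v → R v u)
    (hqx : R .q .x → Fits G f .q .x) (hqs : ∀ j, R .q (.s j) → Fits G f .q (.s j))
    (hqv : ∀ i, R .q (.v i) → Fits G f .q (.v i)) (hxs : ∀ j, R .x (.s j) → Fits G f .x (.s j))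
    (hxv : ∀ i, R .x (.v i) → Fits G f .x (.v i))
    (hss : ∀ i j, i ≠ j → R (.s i) (.s j) → Fits G f (.s i) (.s j))
    (hvs : ∀ i j, R (.v i) (.s j) → Fits G f (.v i) (.s j))
    (hvv : ∀ i j, i ≠ j → R (.v i) (.v j) → Fits G f (.v i) (.v j)) :
    ∀ u v, u ≠ v → R u v → Fits G f u v := by
  rintro (_ | _ | i | i) (_ | _ | j | j) huv h
  all_goals first | exact (huv rfl).elim | skip
  · exact hqx h
  · exact hqs j h
  · exact hqv j h
  · exact (hqx (hR _ _ h)).symm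
  · exact hxs j h
  · exact hxv j h
  · exact (hqs i (hR _ _ h)).symm
  · exact (hxs i (hR _ _ h)).symm
  · exact hss i j (fun h => huv (h ▸ rfl)) h
  · exact (hvs j i (hR _ _ h)).symm
  · exact (hqv i (hR _ _ h)).symm
  · exact (hxv i (hR _ _ h)).symm
  · exact hvs i j h
  · exact hvv i j (fun h => huv (h ▸ rfl)) h

lemma V16.forall_fits {G : SimpleGraph (V16 r)} {f : V16 r → (ℕ × ℕ) × (ℕ × ℕ)}
    {R : V16 r → V16 r → Prop} (hR : ∀ u v, R u v → R v u)
    (hab : R .a .b → Fits G f .a .b) (has : ∀ j, R .a (.s j) → Fits G f .a (.s j))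
    (hav : ∀ i, R .a (.v i) → Fits G f .a (.v i)) (hbs : ∀ j, R .b (.s j) → Fits G f .b (.s j))
    (hbv : ∀ i, R .b (.v i) → Fits G f .b (.v i))
    (hss : ∀ i j, i ≠ j → R (.s i) (.s j) → Fits G f (.s i) (.s j))
    (hvs : ∀ i j, R (.v i) (.s j) → Fits G f (.v i) (.s j))
    (hvv : ∀ i j, i ≠ j → R (.v i) (.v j) → Fits G f (.v i) (.v j)) :
    ∀ u v, u ≠ v → R u v → Fits G f u v := by
  rintro (_ | _ | i | i) (_ | _ | j | j) huv h
  all_goals first | exact (huv rfl).elim | skip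
  · exact hab h
  · exact has j h
  · exact hav j h
  · exact (hab (hR _ _ h)).symm
  · exact hbs j h
  · exact hbv j h
  · exact (has i (hR _ _ h)).symm
  · exact (hbs i (hR _ _ h)).symm
  · exact hss i j (fun h => huv (h ▸ rfl)) h
  · exact (hvs j i (hR _ _ h)).symm
  · exact (hav i (hR _ _ h)).symm
  · exact (hbv i (hR _ _ h)).symm
  · exact hvs i j h
  · exact hvv i j (fun h => huv (h ▸ rfl)) h

lemma V15.forall_fits {G : SimpleGraph (V15 r)} {f : V15 r → (ℕ × ℕ) × (ℕ × ℕ)}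
    {R : V15 r → V15 r → Prop} (hR : ∀ u v, R u v → R v u)
    (hqx : R .q .x → Fits G f .q .x) (hqy : R .q .y → Fits G f .q .y)
    (hxy : R .x .y → Fits G f .x .y) (hqs : ∀ j, R .q (.s j) → Fits G f .q (.s j))
    (hqv : ∀ i, R .q (.v i) → Fits G f .q (.v i)) (hxs : ∀ j, R .x (.s j) → Fits G f .x (.s j))
    (hxv : ∀ i, R .x (.v i) → Fits G f .x (.v i)) (hys : ∀ j, R .y (.s j) → Fits G f .y (.s j))
    (hyv : ∀ i, R .y (.v i) → Fits G f .y (.v i))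
    (hss : ∀ i j, i ≠ j → R (.s i) (.s j) → Fits G f (.s i) (.s j))
    (hvs : ∀ i j, R (.v i) (.s j) → Fits G f (.v i) (.s j))
    (hvv : ∀ i j, i ≠ j → R (.v i) (.v j) → Fits G f (.v i) (.v j)) :
    ∀ u v, u ≠ v → R u v → Fits G f u v := by
  rintro (_ | _ | _ | i | i) (_ | _ | _ | j | j) huv h
  all_goals first | exact (huv rfl).elim | skip
  · exact hqx h
  · exact hqy h
  · exact hqs j h
  · exact hqv j h
  · exact (hqx (hR _ _ h)).symm
  · exact hxy h
  · exact hxs j h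
  · exact hxv j h
  · exact (hqy (hR _ _ h)).symm
  · exact (hxy (hR _ _ h)).symm
  · exact hys j h
  · exact hyv j h
  · exact (hqs i (hR _ _ h)).symm
  · exact (hxs i (hR _ _ h)).symm
  · exact (hys i (hR _ _ h)).symm
  · exact hss i j (fun h => huv (h ▸ rfl)) h
  · exact (hvs j i (hR _ _ h)).symm
  · exact (hqv i (hR _ _ h)).symm
  · exact (hxv i (hR _ _ h)).symm
  · exact (hyv i (hR _ _ h)).symm
  · exact hvs i j h
  · exact hvv i j (fun h => huv (h ▸ rfl)) h

end Fits

/-! ### `F14` -/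

lemma isCliqueChain_F14 (r : ℕ) : IsCliqueChain (F14 r) V13.s V13.v where
  ss i j hij := by simp [F14, hij]
  vs i l := by
    simp [F14]
    omega
  vv i j := by simp [F14]

lemma F14_adj_x_v {r : ℕ} (i : Fin (2 * r + 2)) :
    (F14 r).Adj .x (.v i) ↔ i.val = 0 ∨ i.val = 2 * r + 1 := by
  simp [F14]

/-- With `q` on side `1`, the path of `x` needs the leaves of both ends of the chain on side `0`.
They are an odd number of steps apart, so the defect at `j` repairs the parity. For `j = 2 * r + 2`
the last leaf is on side `1`, but then `hd` makes it the deleted one. -/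
lemma exists_model_F14 {r j : ℕ} (hj : 1 ≤ j) (hj' : j ≤ 2 * r + 2) (d : V13 r)
    (hd : ∀ i : Fin (2 * r + 2), i.val + 1 = j → d = .v i ∨ ∃ h : i.val < 2 * r + 1, d = .s ⟨i, h⟩) :
    ∃ f, ∀ u v, u ≠ v → u ≠ d ∧ v ≠ d → Fits (F14 r) f u v := by
  have hG := isCliqueChain_F14 r
  obtain ⟨f, hq, hx, hs, hv⟩ : ∃ f : V13 r → (ℕ × ℕ) × (ℕ × ℕ),
      f .q = ((1, 0), (1, 0)) ∧ f .x = ((0, 1), (0, 2 * r + 2)) ∧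
      (∀ i, f (.s i) = chainCliqueEnds j i.val) ∧
      ∀ i, f (.v i) = ((chainSide j i.val, i.val + 1), (chainSide j i.val, i.val + 1)) :=
    ⟨fun
      | .q => _
      | .x => _
      | .s i => _
      | .v i => _, rfl, rfl, fun _ => rfl, fun _ => rfl⟩
  have hspan : ∀ i, (f (.s i)).1.1 + (f (.s i)).2.1 = 1 := fun i => by
    rw [hs]
    exact chainCliqueEnds_span _ _
  refine ⟨f, V13.forall_fits (fun u v h => h.symm) (fun h => ?_) (fun i _ => ?_) (fun i _ => ?_)
    (fun i _ => ?_) (fun i h => ?_) (fun i i' hii' _ => hG.fits_ss hs hii')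
    (fun i i' h => hG.fits_vs hs hv fun h1 h2 => ?_) (fun i i' hii' _ => hG.fits_vv _ hv hii')⟩
  · refine iff_of_false (by simp [F14]) ?_
    rw [hq, hx]
    simp [Meets]
  · exact fits_true_of_span (by simp [F14]) (hspan i) (by simp [hq]) (by simp [hq])
  · refine iff_of_false (by simp [F14]) ?_
    rw [meets_comm, hv, meets_leaf (by omega), hq]
    simp
  · refine fits_true_of_span (by simp [F14]) (hspan i) ?_ (by simp [hx])
    simp [hx]
  · rw [Fits, meets_comm, hv, meets_leaf (by omega), hx]
    have h1 := chainSide_spec j i.val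
    have h2 : i.val = 2 * r + 1 → i.val + 1 ≠ j := fun h2 h3 => by
      rcases hd i h3 with h4 | ⟨h4, -⟩
      · exact h.2 h4.symm
      · omega
    have hi := i.isLt
    rw [F14_adj_x_v]
    simp only [Prod.mk.injEq]
    omega
  · rcases hd i (by omega) with h3 | ⟨h4, h3⟩
    · exact h.1 h3.symm
    · exact h.2 (h3.symm ▸ congrArg V13.s (Fin.ext h1.symm))

/-- With everything over one spine vertex no parity matters; the only wrong pair is `q`, `x`. -/
lemma exists_center_model_F14 (r : ℕ) :
    ∃ f, ∀ u v, u ≠ v → ((u ≠ .q ∨ v ≠ .x) ∧ (v ≠ .q ∨ u ≠ .x)) → Fits (F14 r) f u v := by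
  have hG := isCliqueChain_F14 r
  obtain ⟨f, hq, hx, hs, hv⟩ : ∃ f : V13 r → (ℕ × ℕ) × (ℕ × ℕ),
      f .q = ((0, 0), (0, 0)) ∧ f .x = ((0, 1), (0, 2 * r + 2)) ∧
      (∀ i, f (.s i) = ((0, i.val + 1), (0, i.val + 2))) ∧
      ∀ i, f (.v i) = ((0, i.val + 1), (0, i.val + 1)) :=
    ⟨fun
      | .q => _
      | .x => _
      | .s i => _
      | .v i => _, rfl, rfl, fun _ => rfl, fun _ => rfl⟩
  refine ⟨f, V13.forall_fits (fun u v h => h.symm) (fun h => ?_) (fun i _ => ?_) (fun i _ => ?_)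
    (fun i _ => ?_) (fun i h => ?_) (fun i i' hii' _ => hG.fits_center_ss hs hii')
    (fun i i' h => hG.fits_center_vs hs hv) (fun i i' hii' _ => hG.fits_vv (fun _ => 0) hv hii')⟩
  · simp at h
  · refine iff_of_true (by simp [F14]) (meets_of_center ?_ ?_ ?_ ?_ ?_ ?_) <;> simp [hq, hs]
  · refine iff_of_false (by simp [F14]) ?_
    rw [meets_comm, hv, meets_leaf (by omega), hq]
    simp
  · refine iff_of_true (by simp [F14]) (meets_of_center ?_ ?_ ?_ ?_ ?_ ?_) <;> simp [hx, hs]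
  · rw [Fits, meets_comm, hv, meets_leaf (by omega), hx]
    simp [F14]

theorem isMinimalNonPathGraph_F14 {r : ℕ} (hr : 1 ≤ r) : IsMinimalNonPathGraph (F14 r) := by
  refine isMinimalNonPathGraph_of_meets (not_isPathGraph_F14 hr) fun d => ?_
  rcases d with _ | _ | i | i
  · obtain ⟨f, hf⟩ := exists_center_model_F14 r
    exact ⟨f, fun u v hu hv huv => hf u v huv ⟨.inl hu, .inl hv⟩⟩
  · obtain ⟨f, hf⟩ := exists_center_model_F14 r
    exact ⟨f, fun u v hu hv huv => hf u v huv ⟨.inr hv, .inr hu⟩⟩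
  · obtain ⟨f, hf⟩ := exists_model_F14 (j := i.val + 1) (by omega) (by omega) (.s i)
      fun l hl => .inr ⟨by omega, congrArg V13.s (Fin.ext (by simp only; omega))⟩
    exact ⟨f, fun u v hu hv huv => hf u v huv ⟨hu, hv⟩⟩
  · obtain ⟨f, hf⟩ := exists_model_F14 (j := i.val + 1) (by omega) (by omega) (.v i)
      fun l hl => .inl (congrArg V13.v (Fin.ext (by omega)))
    exact ⟨f, fun u v hu hv huv => hf u v huv ⟨hu, hv⟩⟩

/-! ### `F15` and `F16` -/

lemma isCliqueChain_F15 (r : ℕ) : IsCliqueChain (F15 r) V15.s V15.v where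
  ss i j hij := by simp [F15, hij]
  vs i l := by
    simp [F15]
    omega
  vv i j := by simp [F15]

lemma F15_adj_x_v {r : ℕ} (i : Fin (2 * r + 2)) : (F15 r).Adj .x (.v i) ↔ i.val = 0 := by
  simp [F15]

lemma F15_adj_y_v {r : ℕ} (i : Fin (2 * r + 2)) :
    (F15 r).Adj .y (.v i) ↔ i.val = 2 * r + 1 := by
  simp [F15]

/-- Again both end leaves are wanted on side `0`, where `x` and `y` meet. For `j = 0` and `j = 2 * r
+ 2` no clique vertex is affected by the defect; just one end is on the wrong side, which is
harmless by `h0` and `hl`. -/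
lemma exists_model_F15 {r j : ℕ} (hj : j ≤ 2 * r + 2) (d : V15 r)
    (hd : ∀ i : Fin (2 * r + 2), i.val < 2 * r + 1 → i.val + 1 = j →
      d = .v i ∨ ∃ h : i.val < 2 * r + 1, d = .s ⟨i, h⟩)
    (h0 : j = 0 → d = .x) (hl : j = 2 * r + 2 → d = .y ∨ d = .v (Fin.last (2 * r + 1))) :
    ∃ f, ∀ u v, u ≠ v → u ≠ d ∧ v ≠ d → Fits (F15 r) f u v := by
  have hG := isCliqueChain_F15 r
  obtain ⟨f, hq, hx, hy, hs, hv⟩ : ∃ f : V15 r → (ℕ × ℕ) × (ℕ × ℕ),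
      f .q = ((1, 0), (1, 0)) ∧ f .x = ((0, 0), (0, 1)) ∧ f .y = ((0, 0), (0, 2 * r + 2)) ∧
      (∀ i, f (.s i) = chainCliqueEnds j i.val) ∧
      ∀ i, f (.v i) = ((chainSide j i.val, i.val + 1), (chainSide j i.val, i.val + 1)) :=
    ⟨fun
      | .q => _
      | .x => _
      | .y => _
      | .s i => _
      | .v i => _, rfl, rfl, rfl, fun _ => rfl, fun _ => rfl⟩
  have hspan : ∀ i, (f (.s i)).1.1 + (f (.s i)).2.1 = 1 := fun i => by
    rw [hs]
    exact chainCliqueEnds_span _ _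
  refine ⟨f, V15.forall_fits (fun u v h => h.symm) (fun h => ?_) (fun h => ?_) (fun h => ?_)
    (fun i _ => ?_) (fun i _ => ?_) (fun i _ => ?_) (fun i h => ?_) (fun i _ => ?_)
    (fun i h => ?_) (fun i i' hii' _ => hG.fits_ss hs hii')
    (fun i i' h => hG.fits_vs hs hv fun h1 h2 => ?_) (fun i i' hii' _ => hG.fits_vv _ hv hii')⟩
  · refine iff_of_false (by simp [F15]) ?_
    rw [hq, hx]
    simp [Meets]
  · refine iff_of_false (by simp [F15]) ?_
    rw [hq, hy]
    simp [Meets]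
  · refine iff_of_true (by simp [F15]) (meets_of_center ?_ ?_ ?_ ?_ ?_ ?_) <;> simp [hx, hy]
  · exact fits_true_of_span (by simp [F15]) (hspan i) (by simp [hq]) (by simp [hq])
  · refine iff_of_false (by simp [F15]) ?_
    rw [meets_comm, hv, meets_leaf (by omega), hq]
    simp
  · exact fits_true_of_span (by simp [F15]) (hspan i) (by simp [hx]) (by simp [hx])
  · rw [Fits, meets_comm, hv, meets_leaf (by omega), hx]
    have h1 := chainSide_spec j i.val
    have h2 : j ≠ 0 := fun h2 => h.1 (h0 h2).symm
    rw [F15_adj_x_v]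
    simp only [Prod.mk.injEq]
    omega
  · exact fits_true_of_span (by simp [F15]) (hspan i) (by simp [hy]) (by simp [hy])
  · rw [Fits, meets_comm, hv, meets_leaf (by omega), hy]
    have h1 := chainSide_spec j i.val
    have h2 : i.val = 2 * r + 1 → j ≠ 2 * r + 2 := fun h2 h3 => by
      rcases hl h3 with h4 | h4
      · exact h.1 h4.symm
      · exact h.2 (h4.symm ▸ congrArg V15.v (Fin.ext h2))
    have hi := i.isLt
    rw [F15_adj_y_v]
    simp only [Prod.mk.injEq]
    omega
  · rcases hd i (by omega) (by omega) with h3 | ⟨h4, h3⟩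
    · exact h.1 h3.symm
    · exact h.2 (h3.symm ▸ congrArg V15.s (Fin.ext h1.symm))

lemma exists_center_model_F15 (r : ℕ) :
    ∃ f, ∀ u v, u ≠ v → u ≠ .q ∧ v ≠ .q → Fits (F15 r) f u v := by
  have hG := isCliqueChain_F15 r
  obtain ⟨f, hx, hy, hs, hv⟩ : ∃ f : V15 r → (ℕ × ℕ) × (ℕ × ℕ),
      f .x = ((0, 0), (0, 1)) ∧ f .y = ((0, 0), (0, 2 * r + 2)) ∧
      (∀ i, f (.s i) = ((0, i.val + 1), (0, i.val + 2))) ∧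
      ∀ i, f (.v i) = ((0, i.val + 1), (0, i.val + 1)) :=
    ⟨fun
      | .q => ((0, 0), (0, 0))
      | .x => _
      | .y => _
      | .s i => _
      | .v i => _, rfl, rfl, fun _ => rfl, fun _ => rfl⟩
  refine ⟨f, V15.forall_fits (fun u v h => h.symm) (fun h => (h.1 rfl).elim)
    (fun h => (h.1 rfl).elim) (fun h => ?_) (fun i h => (h.1 rfl).elim)
    (fun i h => (h.1 rfl).elim) (fun i _ => ?_) (fun i _ => ?_) (fun i _ => ?_)
    (fun i _ => ?_) (fun i i' hii' _ => hG.fits_center_ss hs hii')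
    (fun i i' h => hG.fits_center_vs hs hv) (fun i i' hii' _ => hG.fits_vv (fun _ => 0) hv hii')⟩
  · refine iff_of_true (by simp [F15]) (meets_of_center ?_ ?_ ?_ ?_ ?_ ?_) <;> simp [hx, hy]
  · refine iff_of_true (by simp [F15]) (meets_of_center ?_ ?_ ?_ ?_ ?_ ?_) <;> simp [hx, hs]
  · rw [Fits, meets_comm, hv, meets_leaf (by omega), hx, F15_adj_x_v]
    simp
  · refine iff_of_true (by simp [F15]) (meets_of_center ?_ ?_ ?_ ?_ ?_ ?_) <;> simp [hy, hs]
  · rw [Fits, meets_comm, hv, meets_leaf (by omega), hy, F15_adj_y_v]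
    simp

theorem isMinimalNonPathGraph_F15 {r : ℕ} (hr : 1 ≤ r) : IsMinimalNonPathGraph (F15 r) := by
  refine isMinimalNonPathGraph_of_meets (not_isPathGraph_F15 hr) fun d => ?_
  suffices h : ∃ f, ∀ u v, u ≠ v → u ≠ d ∧ v ≠ d → Fits (F15 r) f u v by
    obtain ⟨f, hf⟩ := h
    exact ⟨f, fun u v hu hv huv => hf u v huv ⟨hu, hv⟩⟩
  rcases d with _ | _ | _ | i | i
  · exact exists_center_model_F15 r
  · exact exists_model_F15 (j := 0) (by omega) .x (fun l _ hl => by omega) (fun _ => rfl)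
      fun h => by omega
  · exact exists_model_F15 (j := 2 * r + 2) le_rfl .y (fun l _ hl => by omega)
      (fun h => by omega) fun _ => .inl rfl
  · exact exists_model_F15 (j := i.val + 1) (by omega) (.s i)
      (fun l h hl => .inr ⟨h, congrArg V15.s (Fin.ext (by simp only; omega))⟩)
      (fun h => by omega) fun h => by omega
  · exact exists_model_F15 (j := i.val + 1) (by omega) (.v i)
      (fun l _ hl => .inl (congrArg V15.v (Fin.ext (by omega))))
      (fun h => by omega) fun h => .inr (congrArg V15.v (Fin.ext (by simp only [Fin.val_last]; omega)))

lemma isCliqueChain_F16 (k : ℕ) : IsCliqueChain (F16 k) V16.s V16.v where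
  ss i j hij := by simp [F16, hij]
  vs i l := by
    simp [F16]
    omega
  vv i j := by simp [F16]

lemma F16_adj_a_v {k : ℕ} (i : Fin (2 * k + 1)) : (F16 k).Adj .a (.v i) ↔ i.val = 0 := by
  simp [F16]

lemma F16_adj_b_v {k : ℕ} (i : Fin (2 * k + 1)) : (F16 k).Adj .b (.v i) ↔ i.val = 2 * k := by
  simp [F16]

/-- Here `a` and `b` occupy opposite spine vertices, so the first leaf is wanted on side `0` and the
last on side `1`, an even number of steps apart. The extreme values of `j` cover the deletion of `a`
and `b`. -/
lemma exists_model_F16 {k j : ℕ} (hj : j ≤ 2 * k + 1) (d : V16 k)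
    (hd : ∀ i : Fin (2 * k + 1), i.val < 2 * k → i.val + 1 = j →
      d = .v i ∨ ∃ h : i.val < 2 * k, d = .s ⟨i, h⟩)
    (h0 : j = 0 → d = .a) (hl : j = 2 * k + 1 → d = .b ∨ d = .v (Fin.last (2 * k))) :
    ∃ f, ∀ u v, u ≠ v → u ≠ d ∧ v ≠ d → Fits (F16 k) f u v := by
  have hG := isCliqueChain_F16 k
  obtain ⟨f, ha, hb, hs, hv⟩ : ∃ f : V16 k → (ℕ × ℕ) × (ℕ × ℕ),
      f .a = ((0, 0), (0, 1)) ∧ f .b = ((1, 0), (1, 2 * k + 1)) ∧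
      (∀ i, f (.s i) = chainCliqueEnds j i.val) ∧
      ∀ i, f (.v i) = ((chainSide j i.val, i.val + 1), (chainSide j i.val, i.val + 1)) :=
    ⟨fun
      | .a => _
      | .b => _
      | .s i => _
      | .v i => _, rfl, rfl, fun _ => rfl, fun _ => rfl⟩
  have hspan : ∀ i, (f (.s i)).1.1 + (f (.s i)).2.1 = 1 := fun i => by
    rw [hs]
    exact chainCliqueEnds_span _ _
  refine ⟨f, V16.forall_fits (fun u v h => h.symm) (fun h => ?_) (fun i _ => ?_) (fun i h => ?_)
    (fun i _ => ?_) (fun i h => ?_) (fun i i' hii' _ => hG.fits_ss hs hii')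
    (fun i i' h => hG.fits_vs hs hv fun h1 h2 => ?_) (fun i i' hii' _ => hG.fits_vv _ hv hii')⟩
  · refine iff_of_false (by simp [F16]) ?_
    rw [ha, hb]
    simp [Meets]
  · exact fits_true_of_span (by simp [F16]) (hspan i) (by simp [ha]) (by simp [ha])
  · rw [Fits, meets_comm, hv, meets_leaf (by omega), ha]
    have h1 := chainSide_spec j i.val
    have h2 : j ≠ 0 := fun h2 => h.1 (h0 h2).symm
    rw [F16_adj_a_v]
    simp only [Prod.mk.injEq]
    omega
  · exact fits_true_of_span (by simp [F16]) (hspan i) (by simp [hb]) (by simp [hb])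
  · rw [Fits, meets_comm, hv, meets_leaf (by omega), hb]
    have h1 := chainSide_spec j i.val
    have h2 : i.val = 2 * k → j ≠ 2 * k + 1 := fun h2 h3 => by
      rcases hl h3 with h4 | h4
      · exact h.1 h4.symm
      · exact h.2 (h4.symm ▸ congrArg V16.v (Fin.ext h2))
    have hi := i.isLt
    rw [F16_adj_b_v]
    simp only [Prod.mk.injEq]
    omega
  · rcases hd i (by omega) (by omega) with h3 | ⟨h4, h3⟩
    · exact h.1 h3.symm
    · exact h.2 (h3.symm ▸ congrArg V16.s (Fin.ext h1.symm))

theorem isMinimalNonPathGraph_F16 {k : ℕ} (hk : 2 ≤ k) : IsMinimalNonPathGraph (F16 k) := by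
  refine isMinimalNonPathGraph_of_meets (not_isPathGraph_F16 hk) fun d => ?_
  suffices h : ∃ f, ∀ u v, u ≠ v → u ≠ d ∧ v ≠ d → Fits (F16 k) f u v by
    obtain ⟨f, hf⟩ := h
    exact ⟨f, fun u v hu hv huv => hf u v huv ⟨hu, hv⟩⟩
  rcases d with _ | _ | i | i
  · exact exists_model_F16 (j := 0) (by omega) .a (fun l _ hl => by omega) (fun _ => rfl)
      fun h => by omega
  · exact exists_model_F16 (j := 2 * k + 1) le_rfl .b (fun l _ hl => by omega)
      (fun h => by omega) fun _ => .inl rfl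
  · exact exists_model_F16 (j := i.val + 1) (by omega) (.s i)
      (fun l h hl => .inr ⟨h, congrArg V16.s (Fin.ext (by simp only; omega))⟩)
      (fun h => by omega) fun h => by omega
  · exact exists_model_F16 (j := i.val + 1) (by omega) (.v i)
      (fun l _ hl => .inl (congrArg V16.v (Fin.ext (by omega))))
      (fun h => by omega) fun h => .inr (congrArg V16.v (Fin.ext (by simp only [Fin.val_last]; omega)))

/-! ### `F13` -/

lemma meets_of_overlap {p q : (ℕ × ℕ) × (ℕ × ℕ)} (hp : p.1 ≠ p.2 ∨ p.1.2 = 0)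
    (hq : q.1 ≠ q.2 ∨ q.1.2 = 0) (x : ℕ) (h₁ : min p.1.1 p.2.1 ≤ x) (h₂ : x ≤ max p.1.1 p.2.1)
    (h₃ : min q.1.1 q.2.1 ≤ x) (h₄ : x ≤ max q.1.1 q.2.1) : Meets p q :=
  .inr (.inr (.inr (.inr ⟨hp, hq, by omega, by omega⟩)))

lemma F13_adj_v_s {r : ℕ} (i : Fin (2 * r + 2)) (l : Fin (2 * r + 1)) :
    (F13 r).Adj (.v i) (.s l) ↔
      (i.val = 0 ∧ 1 ≤ l.val) ∨ (1 ≤ i.val ∧ (l.val + 1 = i.val ∨ l.val = i.val)) := by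
  simp only [F13, fromRel_adj, ne_eq, reduceCtorEq, not_false_eq_true, true_and, or_false]

lemma F13_adj_x_v {r : ℕ} (i : Fin (2 * r + 2)) :
    (F13 r).Adj .x (.v i) ↔ i.val = 0 ∨ i.val = 2 * r + 1 := by
  simp only [F13, fromRel_adj, ne_eq, reduceCtorEq, not_false_eq_true, true_and, false_or]

/-- The path of the clique vertex `s l` of `F13`, represented on the spine `0, 1, 2`. -/
def longCliqueEnds (j l : ℕ) : (ℕ × ℕ) × (ℕ × ℕ) :=
  (if l = 0 then (if j = 0 then 2 else 1, 0)
    else if l = j then (2 - 2 * chainSide (j + 1) (l + 1), 0) else (2 * chainSide (j + 1) l, l),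
    (2 * chainSide (j + 1) (l + 1), l + 1))

/-- Every clique path contains the spine vertices `1` and `2`. It contains `0`, the place of `v 0`,
except that of `s 0` when `j ≠ 0`; for `j = 0` one of `v 0`, `s 0` is deleted. -/
lemma longCliqueEnds_spec (j l : ℕ) :
    (longCliqueEnds j l).1 ≠ (longCliqueEnds j l).2 ∧
      min (longCliqueEnds j l).1.1 (longCliqueEnds j l).2.1 =
        (if l = 0 ∧ j ≠ 0 then 1 else 0) ∧
      max (longCliqueEnds j l).1.1 (longCliqueEnds j l).2.1 = 2 := by
  have h := chainSide_spec (j + 1) l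
  have h' := chainSide_spec (j + 1) (l + 1)
  unfold longCliqueEnds
  split_ifs <;> simp only [ne_eq, Prod.mk.injEq] <;> omega

/-- The spine has three vertices because `x` must meet `v 0` at `0` and `s 0` at `1` while staying
away from `q` at `2`. The other `v i` are leaves at `0` or `2`, with the defect between `v j` and `v
(j+1)`, so that `v (2r+1)` is on the side of `x` unless it is deleted. -/
lemma exists_model_F13 {r j : ℕ} (hj : j ≤ 2 * r + 1) (d : V13 r)
    (hd : ∀ i : Fin (2 * r + 2), i.val = j → d = .v i ∨ ∃ h : i.val < 2 * r + 1, d = .s ⟨i, h⟩) :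
    ∃ f, ∀ u v, u ≠ v → u ≠ d ∧ v ≠ d → Fits (F13 r) f u v := by
  obtain ⟨f, hq, hx, hs, hv0, hv⟩ : ∃ f : V13 r → (ℕ × ℕ) × (ℕ × ℕ),
      f .q = ((2, 0), (2, 0)) ∧ f .x = ((0, 2 * r + 1), (1, 0)) ∧
      (∀ i, f (.s i) = longCliqueEnds j i.val) ∧
      (∀ i : Fin (2 * r + 2), i.val = 0 → f (.v i) = ((0, 0), (0, 0))) ∧
      ∀ i : Fin (2 * r + 2), i.val ≠ 0 →
        f (.v i) = ((2 * chainSide (j + 1) i, i.val), (2 * chainSide (j + 1) i, i.val)) :=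
    ⟨fun
      | .q => _
      | .x => _
      | .s i => _
      | .v i => if i.val = 0 then ((0, 0), (0, 0)) else
          ((2 * chainSide (j + 1) i, i.val), (2 * chainSide (j + 1) i, i.val)),
      rfl, rfl, fun _ => rfl, fun _ h => if_pos h, fun _ h => if_neg h⟩
  refine ⟨f, V13.forall_fits (fun u v h => h.symm) (fun h => ?_) (fun l _ => ?_) (fun i _ => ?_)
    (fun l _ => ?_) (fun i h => ?_) (fun l l' hll' _ => ?_) (fun i l h => ?_)
    (fun i i' hii' _ => ?_)⟩
  · refine iff_of_false (by simp [F13]) ?_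
    rw [hq, hx]
    simp [Meets]
  · have hl := longCliqueEnds_spec j l
    refine iff_of_true (by simp [F13]) (meets_of_overlap ?_ ?_ 2 ?_ ?_ ?_ ?_) <;>
      simp only [hq, hs, hl, ne_eq, not_false_eq_true, true_or, or_true] <;> (try split_ifs) <;>
      omega
  · refine iff_of_false (by simp [F13]) ?_
    by_cases hi : i.val = 0
    · rw [hq, hv0 i hi]
      simp [Meets]
    · rw [meets_comm, hv i hi, meets_leaf hi, hq]
      simp only [Prod.mk.injEq]
      omega
  · have hl := longCliqueEnds_spec j l
    refine iff_of_true (by simp [F13]) (meets_of_overlap ?_ ?_ 1 ?_ ?_ ?_ ?_)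
    · rw [hx]
      simp
    · exact .inl (by rw [hs]; exact hl.1)
    all_goals simp only [hx, hs, hl] <;> (try split_ifs) <;> omega
  · by_cases hi : i.val = 0
    · rw [Fits, F13_adj_x_v, hv0 i hi, hx]
      simp [hi, Meets]
    · have h1 := chainSide_spec (j + 1) i
      have h2 : i.val = 2 * r + 1 → j ≠ 2 * r + 1 := fun h2 h3 => by
        rcases hd i (by omega) with h4 | ⟨h4, -⟩
        · exact h.2 h4.symm
        · omega
      have hlt := i.isLt
      rw [Fits, F13_adj_x_v, meets_comm, hv i hi, meets_leaf hi, hx]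
      simp only [Prod.mk.injEq]
      omega
  · have hl := longCliqueEnds_spec j l
    have hl' := longCliqueEnds_spec j l'
    refine iff_of_true (by simp [F13, hll']) (meets_of_overlap ?_ ?_ 2 ?_ ?_ ?_ ?_)
    · exact .inl (by rw [hs]; exact hl.1)
    · exact .inl (by rw [hs]; exact hl'.1)
    all_goals simp only [hs, hl, hl'] <;> (try split_ifs) <;> omega
  · have hl := longCliqueEnds_spec j l
    have hne : ¬ (i.val = j ∧ l.val = j) := by
      rintro ⟨h1, h2⟩
      rcases hd i h1 with h3 | ⟨h4, h3⟩
      · exact h.1 h3.symm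
      · exact h.2 (h3.symm ▸ congrArg V13.s (Fin.ext (h2.trans h1.symm)))
    by_cases hi : i.val = 0
    · rw [Fits, F13_adj_v_s, hv0 i hi, hs]
      constructor
      · intro h1
        refine meets_of_overlap (.inr rfl) (.inl hl.1) 0 le_rfl le_rfl ?_ (Nat.zero_le _)
        rw [hl.2.1, if_neg (by omega)]
      · intro h1
        by_contra h2
        have hl0 : l.val = 0 := by omega
        have hmin := hl.2.1
        rw [if_pos (by omega)] at hmin
        -- The path of `s 0` stays at positions `1` and `2`, so neither of its ends is the spine
        -- vertex of `v 0`.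
        have h3 : ∀ x : ℕ × ℕ, min (longCliqueEnds j l).1.1 (longCliqueEnds j l).2.1 ≤ x.1 →
            (0, 0) ≠ x := by
          rintro ⟨x, y⟩ hx h4
          simp only [Prod.mk.injEq] at h4
          simp only at hx
          omega
        rcases h1 with h1 | h1 | h1 | h1 | ⟨-, -, -, h1⟩
        · exact h3 _ (min_le_left _ _) h1
        · exact h3 _ (min_le_right _ _) h1
        · exact h3 _ (min_le_left _ _) h1
        · exact h3 _ (min_le_right _ _) h1
        · simp only at h1
          omega
    · have h1 := chainSide_spec (j + 1) i
      rw [Fits, F13_adj_v_s, hv i hi, meets_leaf hi, hs, longCliqueEnds]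
      by_cases h0 : l.val + 1 = i.val
      · rw [h0]
        exact iff_of_true (by omega) (.inr rfl)
      · by_cases h0' : l.val = i.val
        · rw [if_neg (by omega), if_neg (by omega), h0']
          exact iff_of_true (by omega) (.inl rfl)
        · split_ifs <;> simp only [Prod.mk.injEq] <;> omega
  · refine iff_of_false (by simp [F13]) ?_
    have hne : i.val ≠ i'.val := fun h => hii' (Fin.ext h)
    by_cases hi : i.val = 0
    · have hi' : i'.val ≠ 0 := by omega
      rw [meets_comm, hv i' hi', meets_leaf hi', hv0 i hi]
      simp only [Prod.mk.injEq]
      omega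
    · rw [hv i hi, meets_leaf hi]
      by_cases hi' : i'.val = 0
      · rw [hv0 i' hi']
        simp only [Prod.mk.injEq]
        omega
      · rw [hv i' hi']
        simp only [Prod.mk.injEq]
        omega

/-- All clique paths contain the spine vertex `1`, and those other than `s 0` also reach `v 0` at
`0`. Since `x` contains both spine vertices, it wrongly meets `q`, and this is the only wrong pair.
-/
lemma exists_center_model_F13 (r : ℕ) :
    ∃ f, ∀ u v, u ≠ v → ((u ≠ .q ∨ v ≠ .x) ∧ (v ≠ .q ∨ u ≠ .x)) → Fits (F13 r) f u v := by
  obtain ⟨f, hq, hx, hs, hv0, hv⟩ : ∃ f : V13 r → (ℕ × ℕ) × (ℕ × ℕ),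
      f .q = ((1, 0), (1, 0)) ∧ f .x = ((0, 0), (1, 2 * r + 1)) ∧
      (∀ i : Fin (2 * r + 1), f (.s i) = (if i.val = 0 then (1, 0) else (i.val % 2, i.val),
        ((i.val + 1) % 2, i.val + 1))) ∧
      (∀ i : Fin (2 * r + 2), i.val = 0 → f (.v i) = ((0, 0), (0, 0))) ∧
      ∀ i : Fin (2 * r + 2), i.val ≠ 0 → f (.v i) = ((i.val % 2, i.val), (i.val % 2, i.val)) :=
    ⟨fun
      | .q => _
      | .x => _
      | .s i => _
      | .v i => if i.val = 0 then ((0, 0), (0, 0)) else ((i.val % 2, i.val), (i.val % 2, i.val)),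
      rfl, rfl, fun _ => rfl, fun _ h => if_pos h, fun _ h => if_neg h⟩
  have hs' : ∀ l, (f (.s l)).1 ≠ (f (.s l)).2 ∧ min (f (.s l)).1.1 (f (.s l)).2.1 =
      (if l.val = 0 then 1 else 0) ∧ max (f (.s l)).1.1 (f (.s l)).2.1 = 1 := by
    intro l
    rw [hs]
    split_ifs <;> simp only [ne_eq, Prod.mk.injEq] <;> omega
  refine ⟨f, V13.forall_fits (fun u v h => h.symm) (fun h => ?_) (fun l _ => ?_) (fun i _ => ?_)
    (fun l _ => ?_) (fun i h => ?_) (fun l l' hll' _ => ?_) (fun i l h => ?_)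
    (fun i i' hii' _ => ?_)⟩
  · simp at h
  · have hl := hs' l
    refine iff_of_true (by simp [F13]) (meets_of_overlap (.inr (by rw [hq])) (.inl hl.1) 1
      ?_ ?_ ?_ ?_) <;> simp only [hq, hl] <;> (try split_ifs) <;> omega
  · refine iff_of_false (by simp [F13]) ?_
    by_cases hi : i.val = 0
    · rw [hq, hv0 i hi]
      simp [Meets]
    · rw [meets_comm, hv i hi, meets_leaf hi, hq]
      simp only [Prod.mk.injEq]
      omega
  · have hl := hs' l
    refine iff_of_true (by simp [F13]) (meets_of_overlap (.inr (by rw [hx])) (.inl hl.1) 1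
      ?_ ?_ ?_ ?_) <;> simp only [hx, hl] <;> (try split_ifs) <;> omega
  · by_cases hi : i.val = 0
    · rw [Fits, F13_adj_x_v, hv0 i hi, hx]
      simp [hi, Meets]
    · have hlt := i.isLt
      rw [Fits, F13_adj_x_v, meets_comm, hv i hi, meets_leaf hi, hx]
      simp only [Prod.mk.injEq]
      omega
  · have hl := hs' l
    have hl' := hs' l'
    refine iff_of_true (by simp [F13, hll']) (meets_of_overlap (.inl hl.1) (.inl hl'.1) 1
      ?_ ?_ ?_ ?_) <;> simp only [hl, hl'] <;> (try split_ifs) <;> omega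
  · have hl := hs' l
    by_cases hi : i.val = 0
    · rw [Fits, F13_adj_v_s, hv0 i hi]
      by_cases hl0 : l.val = 0
      · rw [hs, if_pos hl0]
        simp [hi, hl0, Meets]
      · refine iff_of_true (by omega) (meets_of_overlap (.inr rfl) (.inl hl.1) 0 le_rfl le_rfl
          ?_ (Nat.zero_le _))
        rw [hl.2.1, if_neg hl0]
    · rw [Fits, F13_adj_v_s, hv i hi, meets_leaf hi, hs]
      split_ifs <;> simp only [Prod.mk.injEq] <;> omega
  · refine iff_of_false (by simp [F13]) ?_
    have hne : i.val ≠ i'.val := fun h => hii' (Fin.ext h)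
    by_cases hi : i.val = 0
    · have hi' : i'.val ≠ 0 := by omega
      rw [meets_comm, hv i' hi', meets_leaf hi', hv0 i hi]
      simp only [Prod.mk.injEq]
      omega
    · rw [hv i hi, meets_leaf hi]
      by_cases hi' : i'.val = 0
      · rw [hv0 i' hi']
        simp only [Prod.mk.injEq]
        omega
      · rw [hv i' hi']
        simp only [Prod.mk.injEq]
        omega

theorem isMinimalNonPathGraph_F13 {r : ℕ} (hr : 1 ≤ r) : IsMinimalNonPathGraph (F13 r) := by
  refine isMinimalNonPathGraph_of_meets (not_isPathGraph_F13 hr) fun d => ?_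
  rcases d with _ | _ | i | i
  · obtain ⟨f, hf⟩ := exists_center_model_F13 r
    exact ⟨f, fun u v hu hv huv => hf u v huv ⟨.inl hu, .inl hv⟩⟩
  · obtain ⟨f, hf⟩ := exists_center_model_F13 r
    exact ⟨f, fun u v hu hv huv => hf u v huv ⟨.inr hv, .inr hu⟩⟩
  · obtain ⟨f, hf⟩ := exists_model_F13 (j := i.val) (by omega) (.s i)
      fun l hl => .inr ⟨by omega, congrArg V13.s (Fin.ext hl.symm)⟩
    exact ⟨f, fun u v hu hv huv => hf u v huv ⟨hu, hv⟩⟩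
  · obtain ⟨f, hf⟩ := exists_model_F13 (j := i.val) (by omega) (.v i)
      fun l hl => .inl (congrArg V13.v (Fin.ext hl.symm))
    exact ⟨f, fun u v hu hv huv => hf u v huv ⟨hu, hv⟩⟩

end PathGraphs

open PathGraphs in
/-- Each of the graphs `F₀, ..., F₁₆` is a minimal non-path graph. -/
theorem theorem3 :
    (∀ n : ℕ, 4 ≤ n → IsMinimalNonPathGraph (F0 n)) ∧
    IsMinimalNonPathGraph F1 ∧
    IsMinimalNonPathGraph F2 ∧
    IsMinimalNonPathGraph F3 ∧
    IsMinimalNonPathGraph F4 ∧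
    (∀ r : ℕ, 2 ≤ r → IsMinimalNonPathGraph (F5 r)) ∧
    IsMinimalNonPathGraph F6 ∧
    IsMinimalNonPathGraph F7 ∧
    IsMinimalNonPathGraph F8 ∧
    IsMinimalNonPathGraph F9 ∧
    (∀ r : ℕ, 3 ≤ r → IsMinimalNonPathGraph (F10 r)) ∧
    (∀ r : ℕ, 1 ≤ r → IsMinimalNonPathGraph (F11 r)) ∧
    (∀ r : ℕ, 1 ≤ r → IsMinimalNonPathGraph (F12 r)) ∧
    (∀ r : ℕ, 1 ≤ r → IsMinimalNonPathGraph (F13 r)) ∧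
    (∀ r : ℕ, 1 ≤ r → IsMinimalNonPathGraph (F14 r)) ∧
    (∀ r : ℕ, 1 ≤ r → IsMinimalNonPathGraph (F15 r)) ∧
    (∀ k : ℕ, 2 ≤ k → IsMinimalNonPathGraph (F16 k)) := by
  exact ⟨fun n hn => isMinimalNonPathGraph_F0 hn, isMinimalNonPathGraph_F1,
    isMinimalNonPathGraph_F2, isMinimalNonPathGraph_F3, isMinimalNonPathGraph_F4,
    fun r hr => isMinimalNonPathGraph_F5 hr, isMinimalNonPathGraph_F6, isMinimalNonPathGraph_F7,
    isMinimalNonPathGraph_F8, isMinimalNonPathGraph_F9, fun r hr => isMinimalNonPathGraph_F10 hr,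
    fun r hr => isMinimalNonPathGraph_F11 hr, fun r hr => isMinimalNonPathGraph_F12 hr,
    fun r hr => isMinimalNonPathGraph_F13 hr, fun r hr => isMinimalNonPathGraph_F14 hr,
    fun r hr => isMinimalNonPathGraph_F15 hr, fun k hk => isMinimalNonPathGraph_F16 hk⟩
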